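/- **Setting.** An agent has a private type $\theta$ distributed on $\Theta=[\underline\theta,\bar\theta]$, $0\le\underline\theta<\bar\theta$, with a continuous density $f>0$. He can choose a quality $q\in Q=[0,q_{\max}]$ at cost $c(q)/\theta$, where $c$ is twice continuously differentiable and strictly convex on $Q$, $c(0)=c'(0)=0$, and $q_{\max}>0$ satisfies $c(q_{\max})=\bar\theta q_{\max}$. A rating is a Markov kernel $\pi$ from $Q$ to a measurable space $S$ of scores; it is deterministic if it is given by a measurable function $Q\to S$. After a score $s$ of an agent who takes the test, a competitive market pays $\omega(s)=\mathbb E[q\mid s]$ (some wage in $Q$ after scores off the path). A type $\theta$ who takes the test chooses $q$ to maximize $\hat w(q)-c(q)/\theta$, where $\hat w(q)=\int\omega\,d\pi(q)$; a type who does not take the test chooses quality $0$ and gets $0$; participation is voluntary. (Payoffs are multiplied by $\theta$, so that they make sense at $\theta=0$.) The rating $\pi$ implements the quality scheme $q:\Theta\to Q$ if $q$ arises in an equilibrium of this game. The principal maximizes expected quality, $v(q,\theta)=q$, that is, $\int_{\underline\theta}^{\bar\theta}q(\theta)f(\theta)\,d\theta$, over ratings $\pi$ and quality schemes $q$ implemented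 by $\pi$. Let $q_f(\theta)=\arg\max_{x\in Q}\{\theta x-c(x)\}$ be the quality chosen under full revelation. **Proposition.** Let $\pi^*$, with the implemented quality scheme $q^*$, be optimal among all deterministic ratings. Let $b\in[\underline\theta,\bar\theta]$ be such that $q^*(\theta)=q_f(\theta)$ for all $\theta\in(b,\bar\theta)$, so that $(b,\bar\theta)$ is the fully revealing region and the types in $[\underline\theta,b)$ form the exclusion region (where $q^*=0$) and the bunching region (where $q^*$ is a positive constant); either part may be empty. Suppose that 1. $f$ is (weakly) increasing on $[\underline\theta,b)$, and 2. $f$ is differentiable on $(b,\bar\theta)$, and both $f(\theta)$ and its elasticity $\theta f'(\theta)/f(\theta)$ are (weakly) decreasing on $(b,\bar\theta)$. Then $\pi^*$, with $q^*$, is optimal among all (possibly stochastic) ratings. (The shape of $q^*$ on $[\underline\theta,b)$ is not needed as a hypothesis.) -/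

import Mathlib

open Set MeasureTheory ProbabilityTheory

/-- The primitives of the rating-design problem with multiplicatively separable cost `c(q)/θ`:
the type interval `[lo, hi]`, the density `f` of the ability `θ`, the set `[0, qmax]` of
qualities, and the cost function `c`. -/
structure RatingModel where
  lo : ℝ
  hi : ℝ
  qmax : ℝ
  f : ℝ → ℝ
  c : ℝ → ℝ
  lo_nonneg : 0 ≤ lo
  lo_lt_hi : lo < hi
  f_cont : ContinuousOn f (Icc lo hi)
  f_pos : ∀ θ ∈ Icc lo hi, 0 < f θ
  f_mass : ∫ θ in lo..hi, f θ = 1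
  qmax_pos : 0 < qmax
  c_smooth : ContDiffOn ℝ 2 c (Icc 0 qmax)
  c_convex : StrictConvexOn ℝ (Icc 0 qmax) c
  c_zero : c 0 = 0
  c_deriv_zero : derivWithin c (Icc 0 qmax) 0 = 0
  /-- The highest quality is the one at which the highest type is just willing to invest, that is,
  the positive `q` with `hi * q - c q = 0`. -/
  c_qmax : c qmax = hi * qmax

namespace RatingModel

/-- The type space `Θ = [lo, hi]`. -/
def Types (M : RatingModel) : Set ℝ := Icc M.lo M.hi

/-- The set `Q = [0, qmax]` of qualities. -/
abbrev Quality (M : RatingModel) : Type := Icc (0 : ℝ) M.qmax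

/-- A quality scheme assigns a quality to every type (values off `Θ` are irrelevant). -/
abbrev Scheme (M : RatingModel) : Type := ℝ → M.Quality

/-- The interim wage `ŵ(x) = E_{s ∼ π(x)}[ω(s)]` of an agent who takes the test with quality `x`,
when the market pays `ω(s)` after the score `s`. -/
noncomputable def interimWage (M : RatingModel) {S : Type} [MeasurableSpace S]
    (π : Kernel M.Quality S) (ω : S → ℝ) (x : M.Quality) : ℝ :=
  ∫ s, ω s ∂(π x)

/-- The payoff `ŵ(x) - c(x)/θ` of type `θ` from taking the test with quality `x`, multiplied by
`θ` (so that it also makes sense for `θ = 0`). The outside option is worth `0`. -/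
noncomputable def payoff (M : RatingModel) {S : Type} [MeasurableSpace S]
    (π : Kernel M.Quality S) (ω : S → ℝ) (θ : ℝ) (x : M.Quality) : ℝ :=
  θ * M.interimWage π ω x - M.c x

/-- Equilibrium of the game induced by the rating `π : Q → Δ(S)`. `P` is the set of types that take
the test, `q` the quality scheme, and `ω s` the wage that the market pays after the score `s`. -/
structure IsEquilibrium (M : RatingModel) {S : Type} [MeasurableSpace S]
    (π : Kernel M.Quality S) (P : Set ℝ) (q : M.Scheme) (ω : S → ℝ) : Prop where
  measurableSet_participation : MeasurableSet P
  participation_subset : P ⊆ M.Types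
  measurable_quality : Measurable q
  measurable_wage : Measurable ω
  /-- Wages are expectations of a quality in `[0, qmax]`, also after scores off the path. -/
  wage_mem : ∀ s, ω s ∈ Icc 0 M.qmax
  /-- `ω(s) = E[q | s]`: for every event `B` of scores, the expected wage on `B` of those who take
  the test is their expected quality on `B`. -/
  bayes : ∀ B : Set S, MeasurableSet B →
    ∫ θ in P, (∫ s in B, ω s ∂(π (q θ))) * M.f θ =
      ∫ θ in P, (q θ : ℝ) * (π (q θ)).real B * M.f θ
  /-- A type that takes the test chooses a best quality, and does not prefer to stay out. -/
  participant : ∀ θ ∈ P,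
    (∀ x : M.Quality, M.payoff π ω θ x ≤ M.payoff π ω θ (q θ)) ∧ 0 ≤ M.payoff π ω θ (q θ)
  /-- A type that stays out invests nothing, and cannot gain by taking the test. -/
  nonparticipant : ∀ θ ∈ M.Types \ P,
    (q θ : ℝ) = 0 ∧ ∀ x : M.Quality, M.payoff π ω θ x ≤ 0

/-- The rating `π` implements the quality scheme `q`. -/
def Implements (M : RatingModel) {S : Type} [MeasurableSpace S]
    (π : Kernel M.Quality S) (q : M.Scheme) : Prop :=
  ∃ (P : Set ℝ) (ω : S → ℝ), M.IsEquilibrium π P q ω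

/-- The principal's objective when she maximizes expected quality, `v(q, θ) = q`. -/
noncomputable def expectedQuality (M : RatingModel) (q : M.Scheme) : ℝ :=
  ∫ θ in M.lo..M.hi, (q θ : ℝ) * M.f θ

/-- The rating `π`, with the quality scheme `q` that it implements, is optimal among all (possibly
stochastic) ratings, over all measurable spaces of scores. -/
def IsOptimal (M : RatingModel) {S : Type} [MeasurableSpace S]
    (π : Kernel M.Quality S) (q : M.Scheme) : Prop :=
  IsMarkovKernel π ∧ M.Implements π q ∧
    ∀ (S' : Type) [MeasurableSpace S'] (π' : Kernel M.Quality S') [IsMarkovKernel π']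
      (q' : M.Scheme), M.Implements π' q' → M.expectedQuality q' ≤ M.expectedQuality q

/-- The deterministic rating `g : Q → S`, with the quality scheme `q` that it implements, is optimal
among all deterministic ratings. -/
def IsOptimalDeterministic (M : RatingModel) {S : Type} [MeasurableSpace S]
    (g : M.Quality → S) (hg : Measurable g) (q : M.Scheme) : Prop :=
  M.Implements (Kernel.deterministic g hg) q ∧
    ∀ (S' : Type) [MeasurableSpace S'] (g' : M.Quality → S') (hg' : Measurable g')
      (q' : M.Scheme), M.Implements (Kernel.deterministic g' hg') q' →
        M.expectedQuality q' ≤ M.expectedQuality q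

/-- The types at which the quality scheme `q` prescribes the full-revelation quality
`q_f(θ) = argmax_x {x - c(x)/θ}`. -/
def fullyRevealed (M : RatingModel) (q : M.Scheme) : Set ℝ :=
  {θ ∈ M.Types | ∀ x : M.Quality, θ * x - M.c x ≤ θ * (q θ : ℝ) - M.c (q θ)}

end RatingModel

/-! Every equilibrium reduces to an interim payoff `U` and wage `W` by type: `U` is convex with
subgradient `W`, the cost is `c (q θ) = θ * W θ - U θ`, and Bayesian wages are feasible, in that
high types together earn no more than the quality they produce (`IsEquilibrium.upper`), with
equality over all types. This relaxation covers stochastic ratings. Optimality among deterministic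
ratings is used only against minimum standards, which are deterministic.

Let `r` be the full-revelation quality at `b < hi`, with `b > 0`. Revelation above `b` forces wages
below `b` to be at most `r`, so an increasing density makes a pass-fail test at `r` at least as good
there (`le_fullRevelation_of_Ioo`, `integral_le_of_monotoneOn`). As raising the standard from `r`
cannot help, the marginal type `t = c r / r` is at least `lo`, and the first-order condition says
that `f` is on average at most `f t` on `[t, b]`. Being increasing, `f` is constant there.

For an arbitrary outcome, put weight `f b` on wages below `b` and integrate by parts above `b`: the
boundary terms at `b` cancel (`expectedQuality_le`). What remains has a sign, because full
revelation gives at least the payoff of choosing `q θ`, and because feasibility survives the weight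
`-θ f'/f`, which is nonnegative and increasing by the hypotheses on `f`. The resulting bound is
attained by the minimum standard `r`, which the given rating weakly beats. If `b = hi`, some
pass-fail test already dominates any outcome. -/

open Filter Topology

/-! ### Envelope calculus for incentive-compatible allocations -/

/-- `W` is a selection of subgradients of `U` on `[a, b]`: the envelope form of incentive
compatibility of an allocation `W` with indirect utility `U`. -/
def IsEnvelope (U W : ℝ → ℝ) (a b : ℝ) : Prop :=
  ∀ x ∈ Icc a b, ∀ y ∈ Icc a b, U y + (x - y) * W y ≤ U x

namespace IsEnvelope

variable {U W : ℝ → ℝ} {a b K : ℝ}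

lemma mono (h : IsEnvelope U W a b) {a' b' : ℝ} (ha : a ≤ a') (hb : b' ≤ b) :
    IsEnvelope U W a' b' := fun x hx y hy =>
  h x ⟨ha.trans hx.1, hx.2.trans hb⟩ y ⟨ha.trans hy.1, hy.2.trans hb⟩

lemma monotoneOn (h : IsEnvelope U W a b) : MonotoneOn W (Icc a b) := by
  intro x hx y hy hxy
  rcases hxy.eq_or_lt with rfl | hlt
  · exact le_rfl
  · have h1 := h x hx y hy
    have h2 := h y hy x hx
    nlinarith

lemma continuousOn (h : IsEnvelope U W a b) (hW : ∀ x ∈ Icc a b, W x ∈ Icc 0 K) :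
    ContinuousOn U (Icc a b) := by
  have key : ∀ x ∈ Icc a b, ∀ y ∈ Icc a b, U y - U x ≤ K * |y - x| := by
    intro x hx y hy
    have h1 := h x hx y hy
    have h2 : (y - x) * W y ≤ K * |y - x| := by
      calc (y - x) * W y ≤ |y - x| * W y :=
            mul_le_mul_of_nonneg_right (le_abs_self _) (hW y hy).1
        _ ≤ |y - x| * K := mul_le_mul_of_nonneg_left (hW y hy).2 (abs_nonneg _)
        _ = _ := mul_comm _ _
    linarith
  rcases (Icc a b).eq_empty_or_nonempty with he | ⟨z, hz⟩
  · simp [he]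
  have hK : 0 ≤ K := (hW z hz).1.trans (hW z hz).2
  refine (LipschitzOnWith.of_dist_le_mul (K := ⟨K, hK⟩) fun x hx y hy => ?_).continuousOn
  rw [Real.dist_eq, Real.dist_eq, abs_sub_le_iff]
  refine ⟨?_, key x hx y hy |>.trans_eq ?_⟩
  · exact key y hy x hx
  · rw [abs_sub_comm]; rfl

/-- The subgradient inequalities at `x` and at `y` trap the linearization error between `0` and `(y
- x) * (W y - W x)`. -/
lemma hasDerivAt_of_continuousAt (h : IsEnvelope U W a b) {x : ℝ} (hx : x ∈ Ioo a b)
    (hc : ContinuousAt W x) : HasDerivAt U (W x) x := by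
  rw [hasDerivAt_iff_isLittleO, Asymptotics.isLittleO_iff]
  intro ε hε
  have hN : Icc a b ∈ 𝓝 x := Icc_mem_nhds hx.1 hx.2
  filter_upwards [hN, Metric.continuousAt_iff'.1 hc ε hε] with y hy hyε
  have h1 := h y hy x (Ioo_subset_Icc_self hx)
  have h2 := h x (Ioo_subset_Icc_self hx) y hy
  rw [Real.dist_eq] at hyε
  rw [smul_eq_mul, Real.norm_eq_abs, Real.norm_eq_abs, abs_of_nonneg (by linarith)]
  calc U y - U x - (y - x) * W x ≤ (y - x) * (W y - W x) := by linarith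
    _ ≤ |(y - x) * (W y - W x)| := le_abs_self _
    _ = |W y - W x| * |y - x| := by rw [abs_mul, mul_comm]
    _ ≤ ε * |y - x| := mul_le_mul_of_nonneg_right hyε.le (abs_nonneg _)

lemma exists_countable_hasDerivAt (h : IsEnvelope U W a b) :
    ∃ s : Set ℝ, s.Countable ∧ ∀ x ∈ Ioo a b \ s, HasDerivAt U (W x) x := by
  refine ⟨_, h.monotoneOn.countable_not_continuousWithinAt, fun x hx => ?_⟩
  refine h.hasDerivAt_of_continuousAt hx.1 ?_
  have : ContinuousWithinAt W (Icc a b) x := by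
    by_contra hcon
    exact hx.2 ⟨Ioo_subset_Icc_self hx.1, hcon⟩
  exact this.continuousAt (Icc_mem_nhds hx.1.1 hx.1.2)

lemma intervalIntegrable (h : IsEnvelope U W a b) (hab : a ≤ b) :
    IntervalIntegrable W volume a b :=
  MonotoneOn.intervalIntegrable (by rw [uIcc_of_le hab]; exact h.monotoneOn)

/-- Integration by parts of the allocation against a density. -/
lemma integral_mul (h : IsEnvelope U W a b) (hab : a ≤ b)
    (hW : ∀ x ∈ Icc a b, W x ∈ Icc 0 K) {g g' : ℝ → ℝ} (hg : ContinuousOn g (Icc a b))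
    (hgd : ∀ x ∈ Ioo a b, HasDerivAt g (g' x) x) (hg' : IntervalIntegrable g' volume a b) :
    ∫ x in a..b, W x * g x = U b * g b - U a * g a - ∫ x in a..b, U x * g' x := by
  obtain ⟨s, hs, hd⟩ := h.exists_countable_hasDerivAt
  have hU := h.continuousOn hW
  have i1 : IntervalIntegrable (fun x => W x * g x) volume a b :=
    (h.intervalIntegrable hab).mul_continuousOn (by rwa [uIcc_of_le hab])
  have i2 : IntervalIntegrable (fun x => U x * g' x) volume a b :=
    hg'.continuousOn_mul (by rwa [uIcc_of_le hab])
  have := integral_eq_of_hasDerivAt_off_countable_of_le (fun x => U x * g x)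
    (fun x => W x * g x + U x * g' x) hab hs (hU.mul hg)
    (fun x hx => (hd x hx).mul (hgd x hx.1)) (i1.add i2)
  rw [intervalIntegral.integral_add i1 i2] at this
  linarith

lemma integral_eq (h : IsEnvelope U W a b) (hab : a ≤ b)
    (hW : ∀ x ∈ Icc a b, W x ∈ Icc 0 K) : ∫ x in a..b, W x = U b - U a := by
  obtain ⟨s, hs, hd⟩ := h.exists_countable_hasDerivAt
  exact integral_eq_of_hasDerivAt_off_countable_of_le U W hab hs (h.continuousOn hW) hd
    (h.intervalIntegrable hab)

/-- Concentrating an allocation of given total above a threshold `t` maximizes its `f`-weighted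
total when `f` is at most `k` below `t`, and at least `k` above wherever the allocation is below
`p` (and vice versa). -/
lemma integral_mul_le_of_threshold (h : IsEnvelope U W a b)
    (hW : ∀ x ∈ Icc a b, W x ∈ Icc 0 K) {f : ℝ → ℝ}
    (hf : ContinuousOn f (Icc a b)) {t k p : ℝ} (ht : t ∈ Icc a b)
    (hlow : ∀ x ∈ Icc a t, f x ≤ k)
    (hhigh : ∀ x ∈ Ioo t b, k * (p - W x) ≤ f x * (p - W x)) :
    ∫ x in a..b, W x * f x ≤ (∫ x in t..b, p * f x) - k * (p * (b - t) - U b + U a) := by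
  have hat := ht.1
  have htb := ht.2
  have hab := hat.trans htb
  have h1 := h.mono le_rfl htb
  have h2 := h.mono hat le_rfl
  have c1 : ContinuousOn f (uIcc a t) := by
    rw [uIcc_of_le hat]; exact hf.mono (Icc_subset_Icc_right htb)
  have c2 : ContinuousOn f (uIcc t b) := by
    rw [uIcc_of_le htb]; exact hf.mono (Icc_subset_Icc_left hat)
  have i1 := (h1.intervalIntegrable hat).mul_continuousOn c1
  have i2 := (h2.intervalIntegrable htb).mul_continuousOn c2
  have e1 : ∫ x in a..t, W x * f x ≤ ∫ x in a..t, k * W x := by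
    refine intervalIntegral.integral_mono_on hat i1
      ((h1.intervalIntegrable hat).const_mul k) fun x hx => ?_
    rw [mul_comm]
    exact mul_le_mul_of_nonneg_right (hlow x hx) (hW x ⟨hx.1, hx.2.trans htb⟩).1
  have i3 : IntervalIntegrable (fun x => p * f x) volume t b :=
    c2.intervalIntegrable.const_mul p
  have i4 : IntervalIntegrable (fun x => k * p - k * W x) volume t b :=
    intervalIntegrable_const.sub ((h2.intervalIntegrable htb).const_mul k)
  have e2 : ∫ x in t..b, W x * f x ≤ ∫ x in t..b, (p * f x - (k * p - k * W x)) := by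
    refine intervalIntegral.integral_mono_on_of_le_Ioo htb i2 (i3.sub i4) fun x hx => ?_
    have := hhigh x hx
    linarith
  rw [intervalIntegral.integral_sub i3 i4, intervalIntegral.integral_sub intervalIntegrable_const
    ((h2.intervalIntegrable htb).const_mul k), intervalIntegral.integral_const,
    intervalIntegral.integral_const_mul k, h2.integral_eq htb
      fun x hx => hW x ⟨hat.trans hx.1, hx.2⟩, smul_eq_mul] at e2
  rw [intervalIntegral.integral_const_mul, h1.integral_eq hat
      fun x hx => hW x ⟨hx.1, hx.2.trans htb⟩] at e1
  -- The halves contribute `k * (U t - U a)` and `k * (U b - U t)`, so `U t` drops out.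
  rw [← intervalIntegral.integral_add_adjacent_intervals i1 i2]
  have : k * (U t - U a) ≤ k * (U t - U a) := le_rfl
  linarith

end IsEnvelope

/-! ### Monotone weights by the layer-cake formula -/

/-- If `h₁` has at least the integral of `h₂` over every upper subset of `I`, then this persists
after weighting with a nonnegative increasing function. -/
lemma integral_mul_le_of_upperSet {I : Set ℝ} (hI : I.OrdConnected) {h₁ h₂ m : ℝ → ℝ}
    (n₁ : ∀ x ∈ I, 0 ≤ h₁ x) (n₂ : ∀ x ∈ I, 0 ≤ h₂ x)
    (i₁ : IntegrableOn h₁ I) (i₂ : IntegrableOn h₂ I)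
    (hm : MonotoneOn m I) (hm0 : ∀ x ∈ I, 0 ≤ m x)
    (j₁ : IntegrableOn (fun x => m x * h₁ x) I) (j₂ : IntegrableOn (fun x => m x * h₂ x) I)
    (hup : ∀ A ⊆ I, MeasurableSet A → (∀ x ∈ A, ∀ y ∈ I, x ≤ y → y ∈ A) →
      ∫ x in A, h₂ x ≤ ∫ x in A, h₁ x) :
    ∫ x in I, m x * h₂ x ≤ ∫ x in I, m x * h₁ x := by
  -- Layer cake: the weighted integral is the integral over levels `t > 0` of the mass on `{t < m}`,
  -- an upper subset of `I` because `m` is increasing.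
  have hIm : MeasurableSet I := hI.measurableSet
  have hmm : AEMeasurable m (volume.restrict I) := aemeasurable_restrict_of_monotoneOn hIm hm
  have conv : ∀ h : ℝ → ℝ, (∀ x ∈ I, 0 ≤ h x) → IntegrableOn h I →
      ∫⁻ x in I, ENNReal.ofReal (m x * h x) =
        ∫⁻ t in Ioi (0 : ℝ), ENNReal.ofReal (∫ x in {x ∈ I | t < m x}, h x) := by
    intro h hn hi
    have hha : AEMeasurable (fun x => ENNReal.ofReal (h x)) (volume.restrict I) :=
      hi.aemeasurable.ennreal_ofReal
    set ν := (volume.restrict I).withDensity fun x => ENNReal.ofReal (h x) with hν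
    have hac : ν ≪ volume.restrict I := withDensity_absolutelyContinuous _ _
    have e1 : ∫⁻ x in I, ENNReal.ofReal (m x * h x) = ∫⁻ x, ENNReal.ofReal (m x) ∂ν := by
      rw [hν, lintegral_withDensity_eq_lintegral_mul₀ hha hmm.ennreal_ofReal]
      refine setLIntegral_congr_fun hIm fun x hx => ?_
      rw [Pi.mul_apply, ENNReal.ofReal_mul (hm0 x hx), mul_comm]
    have hnn : 0 ≤ᵐ[ν] m := hac.ae_le ((ae_restrict_iff' hIm).2 (ae_of_all _ hm0))
    rw [e1, lintegral_eq_lintegral_meas_lt ν hnn (hmm.mono_ac hac)]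
    refine lintegral_congr fun t => ?_
    have hsub : {x ∈ I | t < m x} ⊆ I := fun x hx => hx.1
    have hA : MeasurableSet {x ∈ I | t < m x} := by
      refine OrdConnected.measurableSet ⟨fun x hx y hy z hz => ?_⟩
      have hzI := hI.out hx.1 hy.1 hz
      exact ⟨hzI, hx.2.trans_le (hm hx.1 hzI hz.1)⟩
    have e2 : ν {x | t < m x} = ν {x ∈ I | t < m x} := by
      refine measure_congr ?_
      have : ∀ᵐ x ∂ν, x ∈ I := hac (ae_restrict_mem hIm)
      filter_upwards [this] with x hx
      exact propext ⟨fun hx' => ⟨hx, hx'⟩, fun hx' => hx'.2⟩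
    rw [e2, hν, withDensity_apply _ hA, Measure.restrict_restrict hA,
      inter_eq_self_of_subset_left hsub, ofReal_integral_eq_lintegral_ofReal (hi.mono_set hsub)]
    exact (ae_restrict_iff' hA).2 (ae_of_all _ fun x hx => hn x hx.1)
  have nn : ∀ h : ℝ → ℝ, (∀ x ∈ I, 0 ≤ h x) → 0 ≤ᵐ[volume.restrict I] fun x => m x * h x :=
    fun h hn => (ae_restrict_iff' hIm).2 (ae_of_all _ fun x hx => mul_nonneg (hm0 x hx) (hn x hx))
  rw [integral_eq_lintegral_of_nonneg_ae (nn _ n₂) j₂.aestronglyMeasurable,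
    integral_eq_lintegral_of_nonneg_ae (nn _ n₁) j₁.aestronglyMeasurable, conv _ n₂ i₂]
  refine ENNReal.toReal_mono ?_ ?_
  · exact ((hasFiniteIntegral_iff_ofReal (nn _ n₁)).1 j₁.2).ne
  · rw [conv _ n₁ i₁]
    refine lintegral_mono fun t => ENNReal.ofReal_le_ofReal ?_
    have hA : MeasurableSet {x ∈ I | t < m x} := by
      refine OrdConnected.measurableSet ⟨fun x hx y hy z hz => ?_⟩
      have hzI := hI.out hx.1 hy.1 hz
      exact ⟨hzI, hx.2.trans_le (hm hx.1 hzI hz.1)⟩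
    exact hup _ (fun x hx => hx.1) hA
      fun x hx y hy hxy => ⟨hy, hx.2.trans_le (hm hx.1 hy hxy)⟩

/-! ### Cost function and interim outcomes -/

namespace RatingModel

variable (M : RatingModel)

lemma zero_mem : (0 : ℝ) ∈ Icc 0 M.qmax := ⟨le_rfl, M.qmax_pos.le⟩

lemma c_continuousOn : ContinuousOn M.c (Icc 0 M.qmax) := M.c_smooth.continuousOn

lemma c_hasDerivWithinAt_zero : HasDerivWithinAt M.c 0 (Icc 0 M.qmax) 0 := by
  have := ((M.c_smooth.differentiableOn (by norm_num)) 0 M.zero_mem).hasDerivWithinAt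
  rwa [M.c_deriv_zero] at this

lemma c_nonneg {x : ℝ} (hx : x ∈ Icc 0 M.qmax) : 0 ≤ M.c x := by
  rcases hx.1.eq_or_lt with rfl | hpos
  · exact M.c_zero.ge
  · have := M.c_convex.convexOn.le_slope_of_hasDerivWithinAt M.zero_mem hx hpos
      M.c_hasDerivWithinAt_zero
    rw [slope_def_field, M.c_zero, sub_zero, sub_zero] at this
    exact not_lt.1 fun hn => absurd this (not_le.2 (div_neg_of_neg_of_pos hn hpos))

/-- Strict convexity with `c 0 = 0`: average cost `c x / x` is strictly increasing, so a higher
standard has a higher marginal type. -/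
lemma c_lt_mul {s x : ℝ} (hs : 0 < s) (hs1 : s < 1) (hx : x ∈ Icc 0 M.qmax) (hx0 : 0 < x) :
    M.c (s * x) < s * M.c x := by
  have := M.c_convex.2 M.zero_mem hx hx0.ne (sub_pos.2 hs1) hs (by ring)
  simpa [M.c_zero] using this

lemma c_strictMonoOn : StrictMonoOn M.c (Icc 0 M.qmax) := by
  intro x hx y hy hxy
  have hy0 : 0 < y := hx.1.trans_lt hxy
  have key : ∀ z, 0 < z → z < y → M.c z < M.c y := by
    intro z hz hzy
    have h := M.c_lt_mul (div_pos hz hy0) ((div_lt_one hy0).2 hzy) hy hy0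
    rw [div_mul_cancel₀ _ hy0.ne'] at h
    exact h.trans_le (mul_le_of_le_one_left (M.c_nonneg hy) ((div_lt_one hy0).2 hzy).le)
  rcases hx.1.eq_or_lt with rfl | hpos
  · rw [M.c_zero]
    exact (M.c_nonneg ⟨by linarith, by linarith [hy.2]⟩).trans_lt
      (key (y / 2) (by linarith) (by linarith))
  · exact key x hpos hxy

/-- The interim payoff `U` (times the type) and interim wage `W` of an equilibrium with scheme
`q`, with the feasibility constraints that Bayesian wages impose. -/
structure IsInterimOutcome (q : M.Scheme) (U W : ℝ → ℝ) : Prop where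
  envelope : IsEnvelope U W M.lo M.hi
  wage_mem : ∀ θ ∈ Icc M.lo M.hi, W θ ∈ Icc 0 M.qmax
  nonneg : ∀ θ ∈ Icc M.lo M.hi, 0 ≤ U θ
  cost : ∀ θ ∈ Icc M.lo M.hi, M.c (q θ) = θ * W θ - U θ
  upper : ∀ A ⊆ Icc M.lo M.hi, MeasurableSet A →
    (∀ x ∈ A, ∀ y ∈ Icc M.lo M.hi, x ≤ y → y ∈ A) →
    ∫ θ in A, W θ * M.f θ ≤ ∫ θ in A, (q θ : ℝ) * M.f θ
  total : ∫ θ in M.lo..M.hi, W θ * M.f θ = M.expectedQuality q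

variable {M}

/-- For `x ≤ y` the envelope inequality bounds the cost increase below by `x * (W y - W x) ≥ 0`, and
`c` is strictly increasing. -/
lemma monotoneOn_of_cost {q : M.Scheme} {U W : ℝ → ℝ} (henv : IsEnvelope U W M.lo M.hi)
    (hcost : ∀ θ ∈ Icc M.lo M.hi, M.c (q θ) = θ * W θ - U θ) :
    MonotoneOn (fun θ => (q θ : ℝ)) (Icc M.lo M.hi) := by
  intro x hx y hy hxy
  refine (M.c_strictMonoOn.le_iff_le (q x).2 (q y).2).1 ?_
  rw [hcost x hx, hcost y hy]
  have h1 := henv x hx y hy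
  have h2 := henv.monotoneOn hx hy hxy
  have h3 : 0 ≤ x := M.lo_nonneg.trans hx.1
  nlinarith

lemma IsInterimOutcome.monotoneOn {q : M.Scheme} {U W : ℝ → ℝ} (h : M.IsInterimOutcome q U W) :
    MonotoneOn (fun θ => (q θ : ℝ)) (Icc M.lo M.hi) :=
  monotoneOn_of_cost h.envelope h.cost

lemma integrableOn_f : IntegrableOn M.f (Icc M.lo M.hi) :=
  M.f_cont.integrableOn_compact isCompact_Icc

lemma integrableOn_mul_f {A : Set ℝ} (hA : A ⊆ Icc M.lo M.hi) {h : ℝ → ℝ}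
    (hm : AEStronglyMeasurable h (volume.restrict A)) {K : ℝ} (hK : ∀ θ, |h θ| ≤ K) :
    IntegrableOn (fun θ => h θ * M.f θ) A :=
  (integrableOn_f.mono_set hA).bdd_mul hm (ae_of_all _ hK)

/-! ### From equilibrium to interim outcome -/

section Equilibrium

variable {S : Type} [MeasurableSpace S] {π : Kernel M.Quality S} {P : Set ℝ}
  {q : M.Scheme} {ω : S → ℝ}

lemma IsEquilibrium.integrable_wage [IsMarkovKernel π] (h : M.IsEquilibrium π P q ω) (x : M.Quality) :
    Integrable ω (π x) :=
  Integrable.of_bound h.measurable_wage.aestronglyMeasurable M.qmax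
    (ae_of_all _ fun s => by
      rw [Real.norm_eq_abs, abs_of_nonneg (h.wage_mem s).1]; exact (h.wage_mem s).2)

lemma IsEquilibrium.setIntegral_wage_mem [IsMarkovKernel π] (h : M.IsEquilibrium π P q ω) (x : M.Quality) (B : Set S)
    {r R : ℝ} (hB : MeasurableSet B) (hr : ∀ s ∈ B, r ≤ ω s) (hR : ∀ s ∈ B, ω s ≤ R) :
    r * (π x).real B ≤ ∫ s in B, ω s ∂(π x) ∧ ∫ s in B, ω s ∂(π x) ≤ R * (π x).real B := by
  have hi := (h.integrable_wage x).integrableOn (s := B)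
  constructor
  · have := setIntegral_mono_on (integrableOn_const (C := r) (measure_ne_top _ _)) hi hB hr
    simpa [mul_comm] using this
  · have := setIntegral_mono_on hi (integrableOn_const (C := R) (measure_ne_top _ _)) hB hR
    simpa [mul_comm] using this

lemma IsEquilibrium.measurable_setIntegral (h : M.IsEquilibrium π P q ω) {B : Set S}
    (hB : MeasurableSet B) : Measurable fun θ => ∫ s in B, ω s ∂(π (q θ)) := by
  have : StronglyMeasurable fun x => ∫ s, B.indicator ω s ∂(π x) :=
    (h.measurable_wage.indicator hB).stronglyMeasurable.integral_kernel
  simp_rw [integral_indicator hB] at this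
  exact this.measurable.comp h.measurable_quality

lemma IsEquilibrium.measurable_real (h : M.IsEquilibrium π P q ω) {B : Set S}
    (hB : MeasurableSet B) : Measurable fun θ => (π (q θ)).real B :=
  ((π.measurable_coe hB).comp h.measurable_quality).ennreal_toReal

/-- The interim wage of a type, `0` outside `P`. -/
noncomputable def interimW (M : RatingModel) (π : Kernel M.Quality S) (P : Set ℝ) (q : M.Scheme)
    (ω : S → ℝ) : ℝ → ℝ :=
  P.indicator fun θ => M.interimWage π ω (q θ)

/-- The interim payoff of a type, `0` outside `P`. -/
noncomputable def interimU (M : RatingModel) (π : Kernel M.Quality S) (P : Set ℝ) (q : M.Scheme)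
    (ω : S → ℝ) : ℝ → ℝ :=
  P.indicator fun θ => M.payoff π ω θ (q θ)

lemma IsEquilibrium.interimWage_mem [IsMarkovKernel π] (h : M.IsEquilibrium π P q ω) (x : M.Quality) :
    M.interimWage π ω x ∈ Icc 0 M.qmax := by
  have := h.setIntegral_wage_mem x univ (r := 0) (R := M.qmax) MeasurableSet.univ
    (fun s _ => (h.wage_mem s).1) (fun s _ => (h.wage_mem s).2)
  simpa [interimWage] using this

/-- Type `x` may imitate type `y`, including by staying out, and the payoff of a fixed choice is
affine in the type with slope equal to its interim wage. -/
lemma IsEquilibrium.envelope (h : M.IsEquilibrium π P q ω) :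
    IsEnvelope (M.interimU π P q ω) (M.interimW π P q ω) M.lo M.hi := by
  intro x hx y hy
  have hx0 : ∀ z, M.payoff π ω x z ≤ M.interimU π P q ω x := by
    intro z
    by_cases hxP : x ∈ P
    · rw [interimU, indicator_of_mem hxP]; exact (h.participant x hxP).1 z
    · rw [interimU, indicator_of_notMem hxP]; exact (h.nonparticipant x ⟨hx, hxP⟩).2 z
  by_cases hyP : y ∈ P
  · refine le_trans (le_of_eq ?_) (hx0 (q y))
    rw [interimU, interimW, indicator_of_mem hyP, indicator_of_mem hyP, payoff, payoff]
    ring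
  · rw [interimU, interimW, indicator_of_notMem hyP, indicator_of_notMem hyP]
    by_cases hxP : x ∈ P
    · rw [indicator_of_mem hxP]; simpa using (h.participant x hxP).2
    · rw [indicator_of_notMem hxP]; simp

lemma IsEquilibrium.cost (h : M.IsEquilibrium π P q ω) {θ : ℝ} (hθ : θ ∈ Icc M.lo M.hi) :
    M.c (q θ) = θ * M.interimW π P q ω θ - M.interimU π P q ω θ := by
  by_cases hP : θ ∈ P
  · rw [interimU, interimW, indicator_of_mem hP, indicator_of_mem hP, payoff]; ring
  · rw [interimU, interimW, indicator_of_notMem hP, indicator_of_notMem hP,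
      (h.nonparticipant θ ⟨hθ, hP⟩).1, M.c_zero]; ring

lemma IsEquilibrium.setIntegral_interim (h : M.IsEquilibrium π P q ω) {A : Set ℝ}
    (hA : A ⊆ Icc M.lo M.hi) (hAm : MeasurableSet A) :
    (∫ θ in A, M.interimW π P q ω θ * M.f θ =
      ∫ θ in A ∩ P, M.interimWage π ω (q θ) * M.f θ) ∧
    ∫ θ in A, (q θ : ℝ) * M.f θ = ∫ θ in A ∩ P, (q θ : ℝ) * M.f θ := by
  constructor
  · rw [← setIntegral_indicator h.measurableSet_participation]
    refine setIntegral_congr_fun hAm fun θ _ => ?_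
    by_cases hP : θ ∈ P <;> simp [interimW, hP]
  · rw [← setIntegral_indicator h.measurableSet_participation]
    refine setIntegral_congr_fun hAm fun θ hθ => ?_
    by_cases hP : θ ∈ P
    · simp [hP]
    · simp [hP, (h.nonparticipant θ ⟨hA hθ, hP⟩).1]

/-- Compare scores with a quality cutoff `r` separating `A` from its complement. On scores paying at
most `r`, types in `A` are paid at most their quality. On scores paying more, types outside `A` are
paid at least their quality, so by Bayes' rule types in `A` again get at most theirs. -/
lemma IsEquilibrium.upper [IsMarkovKernel π] (h : M.IsEquilibrium π P q ω) {A : Set ℝ} (hA : A ⊆ Icc M.lo M.hi)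
    (hAm : MeasurableSet A) (hup : ∀ x ∈ A, ∀ y ∈ Icc M.lo M.hi, x ≤ y → y ∈ A) :
    ∫ θ in A, M.interimW π P q ω θ * M.f θ ≤ ∫ θ in A, (q θ : ℝ) * M.f θ := by
  have hmono := monotoneOn_of_cost h.envelope fun θ => h.cost
  obtain ⟨r, hr, hr'⟩ : ∃ r : ℝ, (∀ x ∈ A, r ≤ q x) ∧ ∀ x ∈ Icc M.lo M.hi, x ∉ A → (q x : ℝ) ≤ r := by
    rcases A.eq_empty_or_nonempty with rfl | hne
    · exact ⟨M.qmax, by simp, fun x _ _ => (q x).2.2⟩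
    · have hbdd : BddBelow ((fun θ => (q θ : ℝ)) '' A) :=
        ⟨0, by rintro _ ⟨x, _, rfl⟩; exact (q x).2.1⟩
      refine ⟨sInf ((fun θ => (q θ : ℝ)) '' A), fun x hx => csInf_le hbdd ⟨x, hx, rfl⟩,
        fun x hx hxA => le_csInf (hne.image _) ?_⟩
      rintro _ ⟨y, hy, rfl⟩
      exact hmono hx (hA hy) (le_of_not_ge fun hyx => hxA (hup y hy x hx hyx))
  have hPm := h.measurableSet_participation
  have hPs : P ⊆ Icc M.lo M.hi := h.participation_subset
  obtain ⟨eW, eq⟩ := h.setIntegral_interim hA hAm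
  rw [eW, eq]
  set B : Set S := {s | ω s ≤ r} with hBdef
  have hB : MeasurableSet B := measurableSet_le h.measurable_wage measurable_const
  have mW : ∀ C : Set S, MeasurableSet C → IntegrableOn
      (fun θ => (∫ s in C, ω s ∂(π (q θ))) * M.f θ) P := by
    intro C hC
    refine integrableOn_mul_f hPs (h.measurable_setIntegral hC).aestronglyMeasurable
      (K := M.qmax) fun θ => ?_
    have := h.setIntegral_wage_mem (q θ) C (r := 0) (R := M.qmax) hC
      (fun s _ => (h.wage_mem s).1) (fun s _ => (h.wage_mem s).2)
    rw [zero_mul] at this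
    rw [abs_of_nonneg this.1]
    exact this.2.trans (mul_le_of_le_one_right M.qmax_pos.le measureReal_le_one)
  have mq : ∀ C : Set S, MeasurableSet C → IntegrableOn
      (fun θ => (q θ : ℝ) * (π (q θ)).real C * M.f θ) P := by
    intro C hC
    refine integrableOn_mul_f hPs ((measurable_subtype_coe.comp h.measurable_quality).mul
      (h.measurable_real hC)).aestronglyMeasurable (K := M.qmax) fun θ => ?_
    rw [abs_of_nonneg (mul_nonneg (q θ).2.1 measureReal_nonneg)]
    exact (mul_le_of_le_one_right (q θ).2.1 measureReal_le_one).trans (q θ).2.2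
  have hfpos : ∀ θ ∈ P, 0 ≤ M.f θ := fun θ hθ => (M.f_pos θ (hPs hθ)).le
  have hAP : MeasurableSet (A ∩ P) := hAm.inter hPm
  have sAP : A ∩ P ⊆ P := inter_subset_right
  have hsplitW : ∫ θ in A ∩ P, M.interimWage π ω (q θ) * M.f θ =
      (∫ θ in A ∩ P, (∫ s in B, ω s ∂(π (q θ))) * M.f θ) +
        ∫ θ in A ∩ P, (∫ s in Bᶜ, ω s ∂(π (q θ))) * M.f θ := by
    rw [← integral_add ((mW B hB).mono_set sAP) ((mW _ hB.compl).mono_set sAP)]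
    refine integral_congr_ae (ae_of_all _ fun θ => ?_)
    simp only
    rw [← add_mul, integral_add_compl hB (h.integrable_wage _), interimWage]
  have hsplitq : ∫ θ in A ∩ P, (q θ : ℝ) * M.f θ =
      (∫ θ in A ∩ P, (q θ : ℝ) * (π (q θ)).real B * M.f θ) +
        ∫ θ in A ∩ P, (q θ : ℝ) * (π (q θ)).real Bᶜ * M.f θ := by
    rw [← integral_add ((mq B hB).mono_set sAP) ((mq _ hB.compl).mono_set sAP)]
    refine integral_congr_ae (ae_of_all _ fun θ => ?_)
    simp only
    rw [← add_mul, ← mul_add, probReal_add_probReal_compl hB, mul_one]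
  rw [hsplitW, hsplitq]
  refine add_le_add ?_ ?_
  · refine setIntegral_mono_on ((mW B hB).mono_set sAP) ((mq B hB).mono_set sAP) hAP
      fun θ hθ => mul_le_mul_of_nonneg_right ?_ (hfpos θ hθ.2)
    refine (h.setIntegral_wage_mem (q θ) B (r := 0) (R := r) hB
      (fun s _ => (h.wage_mem s).1) fun s hs => hs).2.trans ?_
    exact mul_le_mul_of_nonneg_right (hr θ hθ.1) measureReal_nonneg
  -- Bayes' rule balances wages and quality over all of `P` on these scores; subtracting the
  -- overpaid types outside `A` leaves the bound on `A`.
  · have hbayes := h.bayes Bᶜ hB.compl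
    have hdiff : ∀ g : ℝ → ℝ, IntegrableOn g P →
        ∫ θ in P, g θ = (∫ θ in A ∩ P, g θ) + ∫ θ in P \ A, g θ := by
      intro g hg
      rw [inter_comm, integral_inter_add_sdiff hAm hg]
    rw [hdiff _ (mW _ hB.compl), hdiff _ (mq _ hB.compl)] at hbayes
    have : ∫ θ in P \ A, (q θ : ℝ) * (π (q θ)).real Bᶜ * M.f θ ≤
        ∫ θ in P \ A, (∫ s in Bᶜ, ω s ∂(π (q θ))) * M.f θ := by
      refine setIntegral_mono_on ((mq _ hB.compl).mono_set sdiff_subset)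
        ((mW _ hB.compl).mono_set sdiff_subset) (hPm.diff hAm)
        fun θ hθ => mul_le_mul_of_nonneg_right ?_ (hfpos θ hθ.1)
      refine le_trans ?_ (h.setIntegral_wage_mem (q θ) Bᶜ (r := r) (R := M.qmax) hB.compl
        (fun s hs => (not_le.1 (show ¬ω s ≤ r from hs)).le) fun s _ => (h.wage_mem s).2).1
      exact mul_le_mul_of_nonneg_right (hr' θ (hPs hθ.1) hθ.2) measureReal_nonneg
    linarith

lemma IsEquilibrium.total [IsMarkovKernel π] (h : M.IsEquilibrium π P q ω) :
    ∫ θ in M.lo..M.hi, M.interimW π P q ω θ * M.f θ = M.expectedQuality q := by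
  obtain ⟨eW, eq⟩ := h.setIntegral_interim (A := Icc M.lo M.hi) subset_rfl
    measurableSet_Icc
  have hb := h.bayes univ MeasurableSet.univ
  have hPs : Icc M.lo M.hi ∩ P = P := inter_eq_self_of_subset_right h.participation_subset
  rw [hPs] at eW eq
  simp only [Measure.restrict_univ, probReal_univ, mul_one] at hb
  rw [expectedQuality, intervalIntegral.integral_of_le M.lo_lt_hi.le,
    intervalIntegral.integral_of_le M.lo_lt_hi.le, ← integral_Icc_eq_integral_Ioc,
    ← integral_Icc_eq_integral_Ioc, eW, eq]
  exact hb

end Equilibrium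

lemma Implements.exists_isInterimOutcome {S : Type} [MeasurableSpace S]
    {π : Kernel M.Quality S} [IsMarkovKernel π] {q : M.Scheme} (h : M.Implements π q) :
    ∃ U W, M.IsInterimOutcome q U W := by
  obtain ⟨P, ω, h⟩ := h
  refine ⟨_, _, h.envelope, fun θ _ => ?_, fun θ _ => ?_, fun θ => h.cost,
    fun A hA hAm hup => h.upper hA hAm hup, h.total⟩
  · by_cases hP : θ ∈ P
    · rw [interimW, indicator_of_mem hP]; exact h.interimWage_mem _
    · rw [interimW, indicator_of_notMem hP]; exact M.zero_mem
  · by_cases hP : θ ∈ P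
    · rw [interimU, indicator_of_mem hP]; exact (h.participant θ hP).2
    · rw [interimU, indicator_of_notMem hP]

end RatingModel

/-! ### Full revelation -/

namespace RatingModel

variable (M : RatingModel)

lemma exists_fullRevelation (θ : ℝ) :
    ∃ x : M.Quality, ∀ y : M.Quality, θ * y - M.c y ≤ θ * x - M.c x := by
  have hc : ContinuousOn (fun x : ℝ => θ * x - M.c x) (Icc 0 M.qmax) :=
    (continuousOn_const.mul continuousOn_id).sub M.c_continuousOn
  obtain ⟨x, hx, hmax⟩ := isCompact_Icc.exists_isMaxOn ⟨0, M.zero_mem⟩ hc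
  exact ⟨⟨x, hx⟩, fun y => hmax y.2⟩

/-- The quality chosen under full revelation. -/
noncomputable def fullRevelation : M.Scheme := fun θ => (M.exists_fullRevelation θ).choose

/-- The payoff (times the type) under full revelation. -/
noncomputable def fullRevelationPayoff (θ : ℝ) : ℝ :=
  θ * M.fullRevelation θ - M.c (M.fullRevelation θ)

lemma le_fullRevelationPayoff (θ : ℝ) {y : ℝ} (hy : y ∈ Icc 0 M.qmax) :
    θ * y - M.c y ≤ M.fullRevelationPayoff θ :=
  (M.exists_fullRevelation θ).choose_spec ⟨y, hy⟩

lemma isEnvelope_fullRevelation (a b : ℝ) :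
    IsEnvelope M.fullRevelationPayoff (fun θ => (M.fullRevelation θ : ℝ)) a b := by
  intro x _ y _
  have := M.le_fullRevelationPayoff x (M.fullRevelation y).2
  rw [fullRevelationPayoff]
  linarith

lemma monotone_fullRevelation : Monotone M.fullRevelation := fun x y hxy =>
  (M.isEnvelope_fullRevelation x y).monotoneOn ⟨le_rfl, hxy⟩ ⟨hxy, le_rfl⟩ hxy

/-- Two distinct maximizers would be beaten by their midpoint, by strict convexity. -/
lemma eq_fullRevelation {θ x : ℝ} (hx : x ∈ Icc 0 M.qmax)
    (hmax : ∀ y ∈ Icc 0 M.qmax, θ * y - M.c y ≤ θ * x - M.c x) : x = M.fullRevelation θ := by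
  by_contra hne
  have hz := (M.fullRevelation θ).2
  have h1 := M.c_convex.2 hx hz hne (show (0 : ℝ) < 1 / 2 by norm_num)
    (show (0 : ℝ) < 1 / 2 by norm_num) (by norm_num)
  have hm : (1 / 2 : ℝ) • x + (1 / 2 : ℝ) • (M.fullRevelation θ : ℝ) ∈ Icc 0 M.qmax :=
    M.c_convex.1 hx hz (by norm_num) (by norm_num) (by norm_num)
  have h2 := M.le_fullRevelationPayoff θ hm
  have h3 := hmax _ hz
  rw [fullRevelationPayoff] at h2
  simp only [smul_eq_mul] at h1 h2
  linarith

lemma tendsto_fullRevelation (b : ℝ) :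
    Tendsto (fun θ => (M.fullRevelation θ : ℝ)) (𝓝[>] b) (𝓝 (M.fullRevelation b)) := by
  have hmono : Monotone fun θ => (M.fullRevelation θ : ℝ) := fun x y hxy =>
    M.monotone_fullRevelation hxy
  have hbdd : BddBelow ((fun θ => (M.fullRevelation θ : ℝ)) '' Ioi b) :=
    ⟨0, by rintro _ ⟨x, _, rfl⟩; exact (M.fullRevelation x).2.1⟩
  have ht := (hmono.monotoneOn _).tendsto_nhdsGT hbdd
  set r := sInf ((fun θ => (M.fullRevelation θ : ℝ)) '' Ioi b)
  have hr : r ∈ Icc 0 M.qmax :=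
    isClosed_Icc.mem_of_tendsto ht (Eventually.of_forall fun θ => (M.fullRevelation θ).2)
  have hid : Tendsto (fun θ : ℝ => θ) (𝓝[>] b) (𝓝 b) := tendsto_id.mono_left nhdsWithin_le_nhds
  have hcr : Tendsto (fun θ => M.c (M.fullRevelation θ)) (𝓝[>] b) (𝓝 (M.c r)) :=
    (M.c_continuousOn r hr).tendsto.comp (tendsto_nhdsWithin_iff.2
      ⟨ht, Eventually.of_forall fun θ => (M.fullRevelation θ).2⟩)
  have : r = M.fullRevelation b := M.eq_fullRevelation hr fun y hy =>
    le_of_tendsto_of_tendsto ((hid.mul_const y).sub_const (M.c y)) ((hid.mul ht).sub hcr)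
      (Eventually.of_forall fun θ => M.le_fullRevelationPayoff θ hy)
  rwa [this] at ht

lemma fullRevelation_zero : (M.fullRevelation 0 : ℝ) = 0 := by
  refine (M.eq_fullRevelation M.zero_mem fun y hy => ?_).symm
  have := M.c_nonneg hy
  rw [M.c_zero]
  linarith

/-- Since `c` and its derivative vanish at `0`, a small `x > 0` costs at most `θ * x / 2`. -/
lemma fullRevelationPayoff_pos {θ : ℝ} (hθ : 0 < θ) : 0 < M.fullRevelationPayoff θ := by
  have h := M.c_hasDerivWithinAt_zero.hasFDerivWithinAt.isLittleO
  have h' := (Asymptotics.isLittleO_iff.1 h) (half_pos hθ)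
  have hsub : Ioc 0 M.qmax ⊆ Icc 0 M.qmax := Ioc_subset_Icc_self
  have h'' := nhdsWithin_mono 0 hsub h'
  have hne : (𝓝[Ioc 0 M.qmax] (0 : ℝ)).NeBot := by
    rw [nhdsWithin_Ioc_eq_nhdsGT M.qmax_pos]; infer_instance
  obtain ⟨x, hx, hxm⟩ := ((show ∀ᶠ x in 𝓝[Ioc 0 M.qmax] (0 : ℝ), _ from h'').and
    self_mem_nhdsWithin).exists
  have := M.le_fullRevelationPayoff θ (hsub hxm)
  simp only [M.c_zero, sub_zero, ContinuousLinearMap.toSpanSingleton_apply,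
    smul_zero] at hx
  rw [Real.norm_eq_abs, Real.norm_eq_abs, abs_of_pos hxm.1] at hx
  have h1 := le_abs_self (M.c x)
  nlinarith [hxm.1, mul_pos hθ hxm.1]

/-- The optimal payoff is positive, whereas quality `0` yields `0` and `qmax` yields at most `0` for
types up to `hi`. -/
lemma fullRevelation_mem_Ioo {θ : ℝ} (hθ : 0 < θ) (hθ' : θ ≤ M.hi) :
    (M.fullRevelation θ : ℝ) ∈ Ioo 0 M.qmax := by
  have hU := M.fullRevelationPayoff_pos hθ
  rw [fullRevelationPayoff] at hU
  have hq := (M.fullRevelation θ).2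
  refine ⟨hq.1.lt_of_ne fun h => ?_, hq.2.lt_of_ne fun h => ?_⟩
  · rw [← h, M.c_zero] at hU; simp at hU
  · rw [h, M.c_qmax] at hU
    nlinarith [M.qmax_pos]

lemma hasDerivAt_c_fullRevelation {θ : ℝ} (hθ : 0 < θ) (hθ' : θ ≤ M.hi) :
    HasDerivAt M.c θ (M.fullRevelation θ) := by
  have hq := M.fullRevelation_mem_Ioo hθ hθ'
  have hN : Icc 0 M.qmax ∈ 𝓝 (M.fullRevelation θ : ℝ) := Icc_mem_nhds hq.1 hq.2
  have hd : HasDerivAt M.c (deriv M.c (M.fullRevelation θ)) (M.fullRevelation θ) :=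
    ((M.c_smooth.differentiableOn (by norm_num)).differentiableAt hN).hasDerivAt
  have hloc : IsLocalMax (fun x => θ * x - M.c x) (M.fullRevelation θ : ℝ) := by
    filter_upwards [hN] with y hy using M.le_fullRevelationPayoff θ hy
  have := hloc.hasDerivAt_eq_zero (((hasDerivAt_id _).const_mul θ).sub hd)
  rw [mul_one, sub_eq_zero] at this
  rwa [← this] at hd

/-! ### Minimum standards -/

/-- The scheme in which types for whom the minimum standard `p` is worth its cost choose
the better of `p` and their full-revelation quality, while all others choose `0`. -/
noncomputable def minimumStandard (p : M.Quality) : M.Scheme := fun θ =>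
  if M.c p ≤ θ * p then max p (M.fullRevelation θ) else ⟨0, M.zero_mem⟩

/-- The rating that reveals qualities from `p` on and pools lower ones with quality `0`. -/
noncomputable def minimumStandardRating (p x : M.Quality) : M.Quality :=
  if x < p then ⟨0, M.zero_mem⟩ else x

lemma measurable_minimumStandardRating (p : M.Quality) :
    Measurable (M.minimumStandardRating p) :=
  Measurable.ite measurableSet_Iio measurable_const measurable_id

lemma measurable_minimumStandard (p : M.Quality) : Measurable (M.minimumStandard p) :=
  Measurable.ite (measurableSet_le measurable_const (measurable_id.mul_const _))
    (measurable_const.max M.monotone_fullRevelation.measurable) measurable_const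

lemma minimumStandardRating_minimumStandard (p : M.Quality) (θ : ℝ) :
    M.minimumStandardRating p (M.minimumStandard p θ) = M.minimumStandard p θ := by
  rw [minimumStandardRating]
  split_ifs with h
  · rw [minimumStandard] at h ⊢
    split_ifs at h ⊢ with h'
    · exact absurd (le_max_left _ _) (not_le.2 h)
    · rfl
  · rfl

/-- If `p` is worth its cost but exceeds the full-revelation quality, concavity of the payoff makes
it fall from `p` on. If `p` is not worth its cost, increasing average cost makes every larger
quality not worth it either. -/
lemma minimumStandard_best (p : M.Quality) (θ : ℝ) {y : ℝ} (hy : y ∈ Icc 0 M.qmax)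
    (hyp : y = 0 ∨ (p : ℝ) ≤ y) :
    θ * y - M.c y ≤ θ * (M.minimumStandard p θ : ℝ) - M.c (M.minimumStandard p θ) := by
  rw [minimumStandard]
  split_ifs with h
  · rcases le_or_gt p (M.fullRevelation θ) with hq | hq
    · rw [max_eq_right hq]; exact M.le_fullRevelationPayoff θ hy
    · rw [max_eq_left hq.le]
      rcases hyp with rfl | hyp
      · rw [M.c_zero]; linarith
      · have hq' : (M.fullRevelation θ : ℝ) < p := hq
        have hd : 0 < y - (M.fullRevelation θ : ℝ) := by linarith
        have hU := M.le_fullRevelationPayoff θ hy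
        rw [fullRevelationPayoff] at hU
        have hconv := M.c_convex.convexOn.2 (M.fullRevelation θ).2 hy
          (show 0 ≤ (y - (p : ℝ)) / (y - (M.fullRevelation θ : ℝ)) from
            div_nonneg (by linarith) hd.le)
          (show 0 ≤ ((p : ℝ) - (M.fullRevelation θ : ℝ)) / (y - (M.fullRevelation θ : ℝ)) from
            div_nonneg (by linarith) hd.le)
          (by field_simp; ring)
        have hp : ((y - (p : ℝ)) / (y - (M.fullRevelation θ : ℝ))) • (M.fullRevelation θ : ℝ) +
            (((p : ℝ) - (M.fullRevelation θ : ℝ)) / (y - (M.fullRevelation θ : ℝ))) • y = (p : ℝ) := by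
          simp only [smul_eq_mul]; field_simp; ring
        rw [hp] at hconv
        simp only [smul_eq_mul] at hconv
        rw [div_mul_eq_mul_div, div_mul_eq_mul_div, ← add_div, le_div_iff₀ hd] at hconv
        refine le_of_mul_le_mul_right ?_ hd
        nlinarith [mul_le_mul_of_nonneg_left hU (show 0 ≤ y - (p : ℝ) by linarith)]
  · simp only [M.c_zero, mul_zero, sub_zero]
    rcases hyp with rfl | hyp
    · rw [M.c_zero]; simp
    · have hp0 : 0 < (p : ℝ) := by
        refine p.2.1.lt_of_ne fun h0 => h ?_
        rw [← h0, M.c_zero]; simp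
      have hy0 : 0 < y := hp0.trans_le hyp
      rcases hyp.eq_or_lt with rfl | hlt
      · linarith
      · have h1 := M.c_lt_mul (div_pos hp0 hy0) ((div_lt_one hy0).2 hlt) hy hy0
        rw [div_mul_cancel₀ _ hy0.ne', div_mul_eq_mul_div, lt_div_iff₀ hy0] at h1
        refine le_of_mul_le_mul_left ?_ hp0
        nlinarith [mul_le_mul_of_nonneg_right (not_le.1 h).le hy0.le]

lemma implements_minimumStandard (p : M.Quality) :
    M.Implements (Kernel.deterministic _ (M.measurable_minimumStandardRating p))
      (M.minimumStandard p) := by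
  have hpay : ∀ θ x, M.payoff (Kernel.deterministic _ (M.measurable_minimumStandardRating p))
      (fun s : M.Quality => (s : ℝ)) θ x = θ * (M.minimumStandardRating p x : ℝ) - M.c x := by
    intro θ x
    rw [payoff, interimWage, Kernel.integral_deterministic]
  -- All types take the test and the wage is the score itself; excluded types get score and wage
  -- `0`.
  refine ⟨M.Types, fun s => (s : ℝ), measurableSet_Icc, subset_rfl,
    M.measurable_minimumStandard p, measurable_subtype_coe, fun s => s.2, fun B hB => ?_,
    fun θ hθ => ⟨fun x => ?_, ?_⟩, fun θ hθ => absurd hθ.1 hθ.2⟩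
  · congr 1
    ext θ
    congr 1
    rw [Kernel.deterministic_apply, minimumStandardRating_minimumStandard, measureReal_def,
      Measure.dirac_apply' _ hB, ← integral_indicator hB, integral_dirac]
    by_cases h : M.minimumStandard p θ ∈ B <;> simp [h]
  · rw [hpay, hpay, minimumStandardRating_minimumStandard]
    have hx : M.minimumStandardRating p x ≤ x := by
      rw [minimumStandardRating]
      split_ifs
      · exact x.2.1
      · exact le_rfl
    have hc := M.c_strictMonoOn.monotoneOn (M.minimumStandardRating p x).2 x.2 hx
    have hb := M.minimumStandard_best p θ (M.minimumStandardRating p x).2 (by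
      rw [minimumStandardRating]
      split_ifs with h
      · exact Or.inl rfl
      · exact Or.inr (not_lt.1 h))
    linarith
  · rw [hpay, minimumStandardRating_minimumStandard]
    have := M.minimumStandard_best p θ M.zero_mem (Or.inl rfl)
    rwa [M.c_zero, mul_zero, sub_zero] at this

variable {M}

lemma intervalIntegrable_scheme {q : M.Scheme} (hq : Measurable q) {a b : ℝ} (ha : M.lo ≤ a)
    (hab : a ≤ b) (hb : b ≤ M.hi) :
    IntervalIntegrable (fun θ => (q θ : ℝ) * M.f θ) volume a b := by
  rw [intervalIntegrable_iff_integrableOn_Icc_of_le hab]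
  refine integrableOn_mul_f (Icc_subset_Icc ha hb)
    (measurable_subtype_coe.comp hq).aestronglyMeasurable (K := M.qmax) fun θ => ?_
  rw [abs_of_nonneg (q θ).2.1]
  exact (q θ).2.2

lemma intervalIntegrable_f {a b : ℝ} (ha : M.lo ≤ a) (hab : a ≤ b) (hb : b ≤ M.hi) :
    IntervalIntegrable M.f volume a b := by
  rw [intervalIntegrable_iff_integrableOn_Icc_of_le hab]
  exact integrableOn_f.mono_set (Icc_subset_Icc ha hb)

/-- Types from `t` on meet the standard; those below contribute nonnegatively, so `t` need not be
the marginal type. -/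
lemma le_expectedQuality_minimumStandard (p : M.Quality) {t b : ℝ} (ht : M.lo ≤ t) (htb : t ≤ b)
    (hb : b ≤ M.hi) (hp : M.c p ≤ t * p) :
    (∫ θ in t..b, (p : ℝ) * M.f θ) +
      ∫ θ in b..M.hi, max (p : ℝ) (M.fullRevelation θ) * M.f θ ≤
        M.expectedQuality (M.minimumStandard p) := by
  have hm := M.measurable_minimumStandard p
  have hs : ∀ θ, t ≤ θ → (M.minimumStandard p θ : ℝ) = max (p : ℝ) (M.fullRevelation θ) := by
    intro θ hθ
    rw [minimumStandard, if_pos (hp.trans (mul_le_mul_of_nonneg_right hθ p.2.1))]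
    exact Monotone.map_max (f := fun x : M.Quality => (x : ℝ)) fun x y hxy => hxy
  have i1 := intervalIntegrable_scheme hm le_rfl ht (htb.trans hb)
  have i2 := intervalIntegrable_scheme hm ht htb hb
  have i3 := intervalIntegrable_scheme hm (ht.trans htb) hb le_rfl
  rw [expectedQuality, ← intervalIntegral.integral_add_adjacent_intervals i1 (i2.trans i3),
    ← intervalIntegral.integral_add_adjacent_intervals i2 i3]
  have e1 : 0 ≤ ∫ θ in M.lo..t, (M.minimumStandard p θ : ℝ) * M.f θ :=
    intervalIntegral.integral_nonneg ht fun θ hθ => mul_nonneg (M.minimumStandard p θ).2.1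
      (M.f_pos θ ⟨hθ.1, hθ.2.trans (htb.trans hb)⟩).le
  have e2 : ∫ θ in t..b, (p : ℝ) * M.f θ ≤ ∫ θ in t..b, (M.minimumStandard p θ : ℝ) * M.f θ := by
    refine intervalIntegral.integral_mono_on htb
      ((intervalIntegrable_f ht htb hb).const_mul _) i2 fun θ hθ => ?_
    refine mul_le_mul_of_nonneg_right ?_ (M.f_pos θ ⟨ht.trans hθ.1, hθ.2.trans hb⟩).le
    rw [hs θ hθ.1]; exact le_max_left _ _
  have e3 : ∫ θ in b..M.hi, max (p : ℝ) (M.fullRevelation θ) * M.f θ =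
      ∫ θ in b..M.hi, (M.minimumStandard p θ : ℝ) * M.f θ := by
    refine intervalIntegral.integral_congr fun θ hθ => ?_
    rw [uIcc_of_le hb] at hθ
    simp only [hs θ (htb.trans hθ.1)]
  linarith

end RatingModel

/-! ### Upper bounds for arbitrary interim outcomes -/

namespace RatingModel

variable {M : RatingModel}

namespace IsInterimOutcome

variable {q : M.Scheme} {U W : ℝ → ℝ}

lemma intervalIntegrable_scheme (h : M.IsInterimOutcome q U W) {a b : ℝ} (ha : M.lo ≤ a)
    (hab : a ≤ b) (hb : b ≤ M.hi) :
    IntervalIntegrable (fun θ => (q θ : ℝ) * M.f θ) volume a b := by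
  have hsub : Icc a b ⊆ Icc M.lo M.hi := Icc_subset_Icc ha hb
  refine IntervalIntegrable.mul_continuousOn (MonotoneOn.intervalIntegrable ?_) ?_ <;>
    rw [uIcc_of_le hab]
  · exact h.monotoneOn.mono hsub
  · exact M.f_cont.mono hsub

lemma intervalIntegrable_wage (h : M.IsInterimOutcome q U W) {a b : ℝ} (ha : M.lo ≤ a)
    (hab : a ≤ b) (hb : b ≤ M.hi) :
    IntervalIntegrable (fun θ => W θ * M.f θ) volume a b := by
  refine ((h.envelope.mono ha hb).intervalIntegrable hab).mul_continuousOn ?_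
  rw [uIcc_of_le hab]
  exact M.f_cont.mono (Icc_subset_Icc ha hb)

lemma tail (h : M.IsInterimOutcome q U W) {t : ℝ} (ht : t ∈ Icc M.lo M.hi) :
    ∫ θ in t..M.hi, W θ * M.f θ ≤ ∫ θ in t..M.hi, (q θ : ℝ) * M.f θ := by
  rw [intervalIntegral.integral_of_le ht.2, intervalIntegral.integral_of_le ht.2]
  exact h.upper _ (fun x hx => ⟨ht.1.trans hx.1.le, hx.2⟩) measurableSet_Ioc
    fun x hx y hy hxy => ⟨hx.1.trans_le hxy, hy.2⟩

lemma total_split (h : M.IsInterimOutcome q U W) {b : ℝ} (hb : b ∈ Icc M.lo M.hi) :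
    M.expectedQuality q = (∫ θ in M.lo..b, W θ * M.f θ) + ∫ θ in b..M.hi, W θ * M.f θ := by
  rw [← h.total, intervalIntegral.integral_add_adjacent_intervals
    (h.intervalIntegrable_wage le_rfl hb.1 hb.2) (h.intervalIntegrable_wage hb.1 hb.2 le_rfl)]

/-- Wages are bounded by the highest quality chosen below the top type, which also bounds
what the top type can obtain. -/
lemma exists_top (h : M.IsInterimOutcome q U W) :
    ∃ r ∈ Icc 0 M.qmax, (∀ θ ∈ Ico M.lo M.hi, W θ ≤ r) ∧ U M.hi ≤ M.hi * r - M.c r := by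
  have hlt := M.lo_lt_hi
  have hbdd : BddAbove ((fun θ => (q θ : ℝ)) '' Ioo M.lo M.hi) :=
    ⟨M.qmax, by rintro _ ⟨x, _, rfl⟩; exact (q x).2.2⟩
  have hmem : ∀ θ, (q θ : ℝ) ∈ Icc 0 M.qmax := fun θ => (q θ).2
  have ht := (h.monotoneOn.mono Ioo_subset_Icc_self).tendsto_nhdsWithin_Ioo_left
    (nonempty_Ioo.2 hlt) hbdd
  have hle : ∀ θ ∈ Ioo M.lo M.hi, (q θ : ℝ) ≤ sSup ((fun θ => (q θ : ℝ)) '' Ioo M.lo M.hi) :=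
    fun θ hθ => le_csSup hbdd ⟨θ, hθ, rfl⟩
  set r := sSup ((fun θ => (q θ : ℝ)) '' Ioo M.lo M.hi)
  have hr : r ∈ Icc 0 M.qmax :=
    isClosed_Icc.mem_of_tendsto ht (Eventually.of_forall hmem)
  -- Types above `t` earn at least `W t` and produce at most `r`, so feasibility on `[t, hi]` gives
  -- `W t ≤ r`.
  have hW : ∀ θ ∈ Ico M.lo M.hi, W θ ≤ r := by
    intro t ht
    have hi := intervalIntegrable_f ht.1 ht.2.le le_rfl
    have h1 : ∫ θ in t..M.hi, W t * M.f θ ≤ ∫ θ in t..M.hi, W θ * M.f θ := by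
      refine intervalIntegral.integral_mono_on ht.2.le (hi.const_mul _)
        (h.intervalIntegrable_wage ht.1 ht.2.le le_rfl) fun θ hθ => ?_
      have hθ' : θ ∈ Icc M.lo M.hi := ⟨ht.1.trans hθ.1, hθ.2⟩
      exact mul_le_mul_of_nonneg_right
        (h.envelope.monotoneOn ⟨ht.1, ht.2.le⟩ hθ' hθ.1) (M.f_pos θ hθ').le
    have h2 : ∫ θ in t..M.hi, (q θ : ℝ) * M.f θ ≤ ∫ θ in t..M.hi, r * M.f θ := by
      refine intervalIntegral.integral_mono_on_of_le_Ioo ht.2.le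
        (h.intervalIntegrable_scheme ht.1 ht.2.le le_rfl) (hi.const_mul _) fun θ hθ => ?_
      have hθ' : θ ∈ Ioo M.lo M.hi := ⟨ht.1.trans_lt hθ.1, hθ.2⟩
      exact mul_le_mul_of_nonneg_right (hle θ hθ') (M.f_pos θ (Ioo_subset_Icc_self hθ')).le
    have h3 := h1.trans ((h.tail ⟨ht.1, ht.2.le⟩).trans h2)
    rw [intervalIntegral.integral_const_mul, intervalIntegral.integral_const_mul] at h3
    refine le_of_mul_le_mul_right h3 (intervalIntegral.intervalIntegral_pos_of_pos_on hi
      (fun θ hθ => M.f_pos θ ⟨ht.1.trans hθ.1.le, hθ.2.le⟩) ht.2)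
  refine ⟨r, hr, hW, ?_⟩
  -- The top type has measure zero, so its own wage and quality are uncontrolled; its payoff is
  -- reached by continuity from below.
  have hU : Tendsto U (𝓝[<] M.hi) (𝓝 (U M.hi)) := by
    rw [← nhdsWithin_Ioo_eq_nhdsLT hlt]
    exact ((h.envelope.continuousOn h.wage_mem) M.hi ⟨hlt.le, le_rfl⟩).mono_left
      (nhdsWithin_mono _ Ioo_subset_Icc_self)
  have hcr : Tendsto (fun θ => M.c (q θ)) (𝓝[<] M.hi) (𝓝 (M.c r)) :=
    (M.c_continuousOn r hr).tendsto.comp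
      (tendsto_nhdsWithin_iff.2 ⟨ht, Eventually.of_forall hmem⟩)
  have hid : Tendsto (fun θ : ℝ => θ) (𝓝[<] M.hi) (𝓝 M.hi) :=
    tendsto_id.mono_left nhdsWithin_le_nhds
  refine le_of_tendsto_of_tendsto hU ((hid.mul_const r).sub hcr) ?_
  filter_upwards [Ioo_mem_nhdsLT hlt] with θ hθ
  have h1 := h.cost θ (Ioo_subset_Icc_self hθ)
  have h2 := mul_le_mul_of_nonneg_left (hW θ ⟨hθ.1.le, hθ.2⟩) (M.lo_nonneg.trans hθ.1.le)
  linarith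

lemma payoff_hi_le (h : M.IsInterimOutcome q U W) : U M.hi ≤ M.fullRevelationPayoff M.hi := by
  obtain ⟨r, hr, -, hU⟩ := h.exists_top
  exact hU.trans (M.le_fullRevelationPayoff _ hr)

/-- With an increasing density, quality on `[lo, b]` is at most that of a pass-fail test. -/
lemma integral_le_of_monotoneOn (h : M.IsInterimOutcome q U W) {b t r : ℝ}
    (hb : b ∈ Icc M.lo M.hi) (hf : MonotoneOn M.f (Icc M.lo b)) (ht : t ∈ Icc M.lo b)
    (htr : t * r = M.c r) (hW : ∀ θ ∈ Ico M.lo b, W θ ≤ r) (hU : U b ≤ b * r - M.c r) :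
    ∫ θ in M.lo..b, W θ * M.f θ ≤ ∫ θ in t..b, r * M.f θ := by
  have hsub : Icc M.lo b ⊆ Icc M.lo M.hi := Icc_subset_Icc_right hb.2
  have key := (h.envelope.mono le_rfl hb.2).integral_mul_le_of_threshold
    (fun x hx => h.wage_mem x (hsub hx)) (M.f_cont.mono hsub) (k := M.f t) (p := r) ht
    (fun x hx => hf ⟨hx.1, hx.2.trans ht.2⟩ ht hx.2)
    (fun x hx => mul_le_mul_of_nonneg_right (hf ht ⟨ht.1.trans hx.1.le, hx.2.le⟩ hx.1.le)
      (sub_nonneg.2 (hW x ⟨ht.1.trans hx.1.le, hx.2⟩)))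
  have hlo := h.nonneg M.lo ⟨le_rfl, M.lo_lt_hi.le⟩
  -- The correction term is nonnegative because `U b ≤ b * r - c r = r * (b - t)` and `U lo ≥ 0`.
  have := mul_nonneg (M.f_pos t (hsub ht)).le
    (show 0 ≤ r * (b - t) - U b + U M.lo by linarith)
  linarith

lemma integral_le_of_wage_le (h : M.IsInterimOutcome q U W) {b r : ℝ} (hb : b ∈ Icc M.lo M.hi)
    (hW : ∀ θ ∈ Ico M.lo b, W θ ≤ r) :
    ∫ θ in M.lo..b, W θ * M.f θ ≤ ∫ θ in M.lo..b, r * M.f θ :=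
  intervalIntegral.integral_mono_on_of_le_Ioo hb.1
    (h.intervalIntegrable_wage le_rfl hb.1 hb.2)
    ((intervalIntegrable_f le_rfl hb.1 hb.2).const_mul _) fun θ hθ =>
      mul_le_mul_of_nonneg_right (hW θ ⟨hθ.1.le, hθ.2⟩) (M.f_pos θ ⟨hθ.1.le, hθ.2.le.trans hb.2⟩).le

/-- The standard is the bound `r` on wages below the top type. Either all types are willing to meet
it, or the marginal type `c r / r` is the threshold of the pass-fail comparison. -/
lemma exists_minimumStandard_ge_of_monotoneOn (h : M.IsInterimOutcome q U W)
    (hf : MonotoneOn M.f (Icc M.lo M.hi)) :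
    ∃ p, M.expectedQuality q ≤ M.expectedQuality (M.minimumStandard p) := by
  obtain ⟨r, hr, hW, hU⟩ := h.exists_top
  have hhi : M.hi ∈ Icc M.lo M.hi := ⟨M.lo_lt_hi.le, le_rfl⟩
  refine ⟨⟨r, hr⟩, ?_⟩
  suffices ∃ t ∈ Icc M.lo M.hi, M.c r ≤ t * r ∧
      ∫ θ in M.lo..M.hi, W θ * M.f θ ≤ ∫ θ in t..M.hi, r * M.f θ by
    obtain ⟨t, ht, hct, hle⟩ := this
    have := le_expectedQuality_minimumStandard ⟨r, hr⟩ ht.1 ht.2 le_rfl hct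
    rw [intervalIntegral.integral_same, add_zero] at this
    rw [← h.total]
    exact hle.trans this
  rcases le_or_gt (M.c r) (M.lo * r) with hc | hc
  · exact ⟨M.lo, ⟨le_rfl, M.lo_lt_hi.le⟩, hc, h.integral_le_of_wage_le hhi hW⟩
  · have hr0 : 0 < r := hr.1.lt_of_ne fun h0 => by
      rw [← h0, M.c_zero] at hc; simp at hc
    have htr : M.c r / r * r = M.c r := div_mul_cancel₀ _ hr0.ne'
    have hU0 := h.nonneg M.hi hhi
    have ht : M.c r / r ∈ Icc M.lo M.hi :=
      ⟨(le_div_iff₀ hr0).2 hc.le, (div_le_iff₀ hr0).2 (by linarith)⟩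
    exact ⟨_, ht, htr.ge, h.integral_le_of_monotoneOn hhi hf ht htr hW hU⟩

/-- If the types in `(b, hi)` choose their full-revelation qualities, then payoffs and wages up
to `b` are at most those under full revelation at `b`. -/
lemma le_fullRevelation_of_Ioo (h : M.IsInterimOutcome q U W) {b : ℝ} (hb : b ∈ Ico M.lo M.hi)
    (hq : ∀ θ ∈ Ioo b M.hi, (q θ : ℝ) = M.fullRevelation θ) :
    U b ≤ M.fullRevelationPayoff b ∧ ∀ θ ∈ Icc M.lo b, W θ ≤ M.fullRevelation b := by
  have hb0 : 0 ≤ b := M.lo_nonneg.trans hb.1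
  have hcU : ContinuousOn U (Icc M.lo M.hi) := h.envelope.continuousOn h.wage_mem
  have hcF : ContinuousOn M.fullRevelationPayoff (Icc M.lo M.hi) :=
    (M.isEnvelope_fullRevelation _ _).continuousOn fun θ _ => (M.fullRevelation θ).2
  have key : ∀ a ∈ Ioo b M.hi,
      U a ≤ M.fullRevelationPayoff a ∧ W a ≤ M.fullRevelation a := by
    intro a ha
    have ha0 : 0 < a := hb0.trans_lt ha.1
    have hla : M.lo ≤ a := hb.1.trans ha.1.le
    have hsub : Icc a M.hi ⊆ Icc M.lo M.hi := Icc_subset_Icc_left hla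
    have hdiff : ∀ θ ∈ Ico a M.hi,
        M.fullRevelationPayoff θ - U θ = θ * (M.fullRevelation θ - W θ) := by
      intro θ hθ
      have := h.cost θ (hsub ⟨hθ.1, hθ.2.le⟩)
      rw [hq θ ⟨ha.1.trans_le hθ.1, hθ.2⟩] at this
      rw [fullRevelationPayoff, this]
      ring
    obtain ⟨s, hs, hd⟩ := (h.envelope.mono hla le_rfl).exists_countable_hasDerivAt
    obtain ⟨s', hs', hd'⟩ := (M.isEnvelope_fullRevelation a M.hi).exists_countable_hasDerivAt
    have hpos : ∀ θ ∈ Icc a M.hi, θ ≠ 0 := fun θ hθ => (ha0.trans_le hθ.1).ne'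
    -- Equal qualities mean equal costs, so the payoff gap is `θ` times the wage gap. Hence gap over
    -- `θ` has zero derivative, is constant, and has the sign it takes at `hi`.
    have hconst := integral_eq_of_hasDerivAt_off_countable_of_le
      (fun θ => (M.fullRevelationPayoff θ - U θ) / θ) (fun _ => 0) ha.2.le (hs.union hs')
      (((hcF.mono hsub).sub (hcU.mono hsub)).div continuousOn_id hpos)
      (fun θ hθ => by
        have hθI := hpos θ (Ioo_subset_Icc_self hθ.1)
        have hD := ((hd' θ ⟨hθ.1, fun hx => hθ.2 (Or.inr hx)⟩).sub
          (hd θ ⟨hθ.1, fun hx => hθ.2 (Or.inl hx)⟩)).div (hasDerivAt_id θ) hθI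
        refine hD.congr_deriv ?_
        simp only [Pi.sub_apply, id_eq, hdiff θ ⟨hθ.1.1.le, hθ.1.2⟩]
        rw [mul_one, mul_comm, sub_self, zero_div])
      intervalIntegrable_const
    simp only [intervalIntegral.integral_zero] at hconst
    have hhi : 0 ≤ (M.fullRevelationPayoff M.hi - U M.hi) / M.hi :=
      div_nonneg (sub_nonneg.2 h.payoff_hi_le) (ha0.trans ha.2).le
    have hD : (M.fullRevelationPayoff a - U a) / a = M.fullRevelation a - W a := by
      rw [hdiff a ⟨le_rfl, ha.2⟩, mul_div_cancel_left₀ _ ha0.ne']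
    have hW : 0 ≤ (M.fullRevelation a : ℝ) - W a := by linarith
    have hU := hdiff a ⟨le_rfl, ha.2⟩
    have := mul_nonneg ha0.le hW
    exact ⟨by linarith, by linarith⟩
  -- Since `b` may be `0`, the bounds are carried to `b` as limits from the right.
  have hev : ∀ᶠ a in 𝓝[>] b, a ∈ Ioo b M.hi := Ioo_mem_nhdsGT hb.2
  have hlim : ∀ g : ℝ → ℝ, ContinuousOn g (Icc M.lo M.hi) → Tendsto g (𝓝[>] b) (𝓝 (g b)) := by
    intro g hg
    rw [← nhdsWithin_Ioo_eq_nhdsGT hb.2]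
    exact (hg b ⟨hb.1, hb.2.le⟩).mono_left
      (nhdsWithin_mono _ fun x hx => ⟨hb.1.trans hx.1.le, hx.2.le⟩)
  constructor
  · exact le_of_tendsto_of_tendsto (hlim _ hcU) (hlim _ hcF)
      (hev.mono fun a ha => (key a ha).1)
  · intro θ hθ
    refine ge_of_tendsto (M.tendsto_fullRevelation b) (hev.mono fun a ha => ?_)
    exact (h.envelope.monotoneOn ⟨hθ.1, hθ.2.trans hb.2.le⟩ ⟨hb.1.trans ha.1.le, ha.2.le⟩
      (hθ.2.trans ha.1.le)).trans (key a ha).2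

/-- Feasibility weighted with `-θ f'(θ)`, which is an increasing multiple of the density when the
elasticity of the density is decreasing. -/
lemma integral_mul_deriv_le (h : M.IsInterimOutcome q U W) {b : ℝ} (hb : b ∈ Ico M.lo M.hi)
    (hd : ∀ θ ∈ Ioo b M.hi, deriv M.f θ ≤ 0)
    (hi : IntervalIntegrable (deriv M.f) volume b M.hi)
    (he : AntitoneOn (fun θ => θ * deriv M.f θ / M.f θ) (Ioo b M.hi)) :
    ∫ θ in b..M.hi, W θ * (θ * -deriv M.f θ) ≤
      ∫ θ in b..M.hi, (q θ : ℝ) * (θ * -deriv M.f θ) := by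
  have hsub : Ioo b M.hi ⊆ Icc M.lo M.hi := fun x hx => ⟨hb.1.trans hx.1.le, hx.2.le⟩
  have hfp : ∀ θ ∈ Ioo b M.hi, 0 < M.f θ := fun θ hθ => M.f_pos θ (hsub hθ)
  have conv : ∀ g : ℝ → ℝ, ∫ θ in b..M.hi, g θ * (θ * -deriv M.f θ) =
      ∫ θ in Ioo b M.hi, -(θ * deriv M.f θ / M.f θ) * (g θ * M.f θ) := by
    intro g
    rw [intervalIntegral.integral_of_le hb.2.le, integral_Ioc_eq_integral_Ioo]
    refine setIntegral_congr_fun measurableSet_Ioo fun θ hθ => ?_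
    have := (hfp θ hθ).ne'
    field_simp
  have hmonoInt : ∀ g : ℝ → ℝ, MonotoneOn g (Icc M.lo M.hi) →
      (∀ θ ∈ Icc M.lo M.hi, g θ ∈ Icc 0 M.qmax) →
      IntegrableOn (fun θ => -(θ * deriv M.f θ / M.f θ) * (g θ * M.f θ)) (Ioo b M.hi) := by
    intro g hg hgb
    have hi' : IntegrableOn (fun θ => g θ * (θ * -deriv M.f θ)) (Ioo b M.hi) := by
      have h1 : IntervalIntegrable (fun θ => θ * -deriv M.f θ) volume b M.hi :=
        hi.neg.continuousOn_mul continuousOn_id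
      rw [intervalIntegrable_iff_integrableOn_Ioo_of_le hb.2.le] at h1
      refine h1.bdd_mul (c := M.qmax) (aemeasurable_restrict_of_monotoneOn measurableSet_Ioo
        (hg.mono hsub)).aestronglyMeasurable ((ae_restrict_iff' measurableSet_Ioo).2
          (ae_of_all _ fun θ hθ => ?_))
      rw [Real.norm_eq_abs, abs_of_nonneg (hgb θ (hsub hθ)).1]
      exact (hgb θ (hsub hθ)).2
    refine hi'.congr_fun (fun θ hθ => ?_) measurableSet_Ioo
    have := (hfp θ hθ).ne'
    simp only
    field_simp
  have hio : ∀ g : ℝ → ℝ, IntervalIntegrable g volume b M.hi → IntegrableOn g (Ioo b M.hi) :=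
    fun g hg => (intervalIntegrable_iff_integrableOn_Ioo_of_le hb.2.le).1 hg
  rw [conv, conv]
  refine integral_mul_le_of_upperSet ordConnected_Ioo
    (fun θ hθ => mul_nonneg (q θ).2.1 (hfp θ hθ).le)
    (fun θ hθ => mul_nonneg (h.wage_mem θ (hsub hθ)).1 (hfp θ hθ).le)
    (hio _ (h.intervalIntegrable_scheme hb.1 hb.2.le le_rfl))
    (hio _ (h.intervalIntegrable_wage hb.1 hb.2.le le_rfl)) he.neg (fun θ hθ => ?_)
    (hmonoInt _ h.monotoneOn fun θ _ => (q θ).2)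
    (hmonoInt _ h.envelope.monotoneOn h.wage_mem) fun A hA hAm hup => ?_
  · rw [neg_nonneg]
    exact div_nonpos_of_nonpos_of_nonneg (mul_nonpos_of_nonneg_of_nonpos
      (M.lo_nonneg.trans (hsub hθ).1) (hd θ hθ)) (hfp θ hθ).le
  · have hhi : M.hi ∈ Icc M.lo M.hi := ⟨M.lo_lt_hi.le, le_rfl⟩
    -- Adding the null point `hi` makes `A` an upper set in the closed type interval.
    have hins : (insert M.hi A : Set ℝ) =ᵐ[volume] A := insert_ae_eq_self _ _
    rw [← setIntegral_congr_set hins, ← setIntegral_congr_set hins]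
    refine h.upper _ (insert_subset hhi (hA.trans hsub)) (hAm.insert _) ?_
    rintro x (rfl | hx) y hy hxy
    · exact Or.inl (le_antisymm hy.2 hxy)
    · rcases hy.2.eq_or_lt with rfl | hlt
      · exact Or.inl rfl
      · exact Or.inr (hup x hx y ⟨(hA hx).1.trans_le hxy, hlt⟩ hxy)

/-- Upper bound on expected quality when the density is constant between the exclusion threshold
`t` and `b`, no larger below, and decreasing with decreasing elasticity above. -/
lemma expectedQuality_le (h : M.IsInterimOutcome q U W) {b t : ℝ} (hb : b ∈ Ico M.lo M.hi)
    (ht : t ∈ Icc M.lo b) (htq : t * M.fullRevelation b = M.c (M.fullRevelation b))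
    (hlow : ∀ θ ∈ Icc M.lo t, M.f θ ≤ M.f b) (hconst : ∀ θ ∈ Icc t b, M.f θ = M.f b)
    (hf : ∀ θ ∈ Ioo b M.hi, HasDerivAt M.f (deriv M.f θ) θ)
    (hd : ∀ θ ∈ Ioo b M.hi, deriv M.f θ ≤ 0)
    (he : AntitoneOn (fun θ => θ * deriv M.f θ / M.f θ) (Ioo b M.hi)) :
    M.expectedQuality q ≤ (∫ θ in t..b, (M.fullRevelation b : ℝ) * M.f θ) +
      ∫ θ in b..M.hi, (M.fullRevelation θ : ℝ) * M.f θ := by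
  have hbI : b ∈ Icc M.lo M.hi := ⟨hb.1, hb.2.le⟩
  have hs1 : Icc M.lo b ⊆ Icc M.lo M.hi := Icc_subset_Icc_right hb.2.le
  have hs2 : Icc b M.hi ⊆ Icc M.lo M.hi := Icc_subset_Icc_left hb.1
  have hlo := h.nonneg M.lo ⟨le_rfl, M.lo_lt_hi.le⟩
  have hUb : M.fullRevelationPayoff b = b * M.fullRevelation b - M.c (M.fullRevelation b) := rfl
  have key := (h.envelope.mono le_rfl hb.2.le).integral_mul_le_of_threshold
    (fun x hx => h.wage_mem x (hs1 hx)) (M.f_cont.mono hs1) (k := M.f b)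
    (p := M.fullRevelation b) ht hlow
    (fun x hx => by rw [hconst x ⟨hx.1.le, hx.2.le⟩])
  have hk : M.f b * (M.fullRevelationPayoff b - U b) ≤
      M.f b * (M.fullRevelation b * (b - t) - U b + U M.lo) :=
    mul_le_mul_of_nonneg_left (by linarith) (M.f_pos b hbI).le
  have hc2 : ContinuousOn M.f (Icc b M.hi) := M.f_cont.mono hs2
  -- A one-signed derivative of a continuous function on a compact interval is integrable.
  have hi : IntervalIntegrable (deriv M.f) volume b M.hi := by
    have := intervalIntegral.intervalIntegrable_deriv_of_nonneg (g := fun θ => -M.f θ)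
      (g' := fun θ => -deriv M.f θ) (a := b) (b := M.hi)
      (by rw [uIcc_of_le hb.2.le]; exact hc2.neg)
      (by rw [min_eq_left hb.2.le, max_eq_right hb.2.le]; exact fun x hx => (hf x hx).neg)
      (by rw [min_eq_left hb.2.le, max_eq_right hb.2.le]; exact fun x hx => by
            have := hd x hx; linarith)
    exact (funext fun θ => by simp : -(fun θ => -deriv M.f θ) = deriv M.f) ▸ this.neg
  have hEW := h.envelope.mono hb.1 le_rfl
  have hEF := M.isEnvelope_fullRevelation b M.hi
  have hFm : ∀ x ∈ Icc b M.hi, (M.fullRevelation x : ℝ) ∈ Icc 0 M.qmax :=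
    fun x _ => (M.fullRevelation x).2
  have p1 := hEW.integral_mul hb.2.le (fun x hx => h.wage_mem x (hs2 hx)) hc2 hf hi
  have p2 := hEF.integral_mul hb.2.le hFm hc2 hf hi
  have iU : IntervalIntegrable (fun x => U x * deriv M.f x) volume b M.hi :=
    hi.continuousOn_mul (by
      rw [uIcc_of_le hb.2.le]; exact hEW.continuousOn fun x hx => h.wage_mem x (hs2 hx))
  have iF : IntervalIntegrable (fun x => M.fullRevelationPayoff x * deriv M.f x) volume b M.hi :=
    hi.continuousOn_mul (by rw [uIcc_of_le hb.2.le]; exact hEF.continuousOn hFm)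
  have hbd : ∀ g : ℝ → ℝ, MonotoneOn g (Icc M.lo M.hi) →
      (∀ θ ∈ Icc M.lo M.hi, g θ ∈ Icc 0 M.qmax) →
      IntervalIntegrable (fun θ => g θ * (θ * -deriv M.f θ)) volume b M.hi := by
    intro g hg hgb
    have h1 : IntervalIntegrable (fun θ => θ * -deriv M.f θ) volume b M.hi :=
      hi.neg.continuousOn_mul continuousOn_id
    rw [intervalIntegrable_iff_integrableOn_Icc_of_le hb.2.le] at h1 ⊢
    refine h1.bdd_mul (c := M.qmax) (aemeasurable_restrict_of_monotoneOn measurableSet_Icc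
      (hg.mono hs2)).aestronglyMeasurable ((ae_restrict_iff' measurableSet_Icc).2
        (ae_of_all _ fun θ hθ => ?_))
    rw [Real.norm_eq_abs, abs_of_nonneg (hgb θ (hs2 hθ)).1]
    exact (hgb θ (hs2 hθ)).2
  have iq := hbd _ h.monotoneOn fun θ _ => (q θ).2
  have iw := hbd _ h.envelope.monotoneOn h.wage_mem
  -- Type `x` could choose `q x` under full revelation, so the payoff gap is at least `x * (q x - W
  -- x)`; multiplying by `f' ≤ 0` reverses this.
  have hcmp : ∫ x in b..M.hi, (M.fullRevelationPayoff x * deriv M.f x - U x * deriv M.f x) ≤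
      ∫ x in b..M.hi, (W x * (x * -deriv M.f x) - (q x : ℝ) * (x * -deriv M.f x)) := by
    refine intervalIntegral.integral_mono_on_of_le_Ioo hb.2.le (iF.sub iU) (iw.sub iq)
      fun x hx => ?_
    have h1 := M.le_fullRevelationPayoff x (q x).2
    have h2 := h.cost x (hs2 (Ioo_subset_Icc_self hx))
    have h3 := mul_nonneg (sub_nonneg.2 (show x * ((q x : ℝ) - W x) ≤
      M.fullRevelationPayoff x - U x by linarith)) (neg_nonneg.2 (hd x hx))
    linarith
  rw [intervalIntegral.integral_sub iF iU, intervalIntegral.integral_sub iw iq] at hcmp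
  have hfeas := h.integral_mul_deriv_le hb hd hi he
  have htop := mul_le_mul_of_nonneg_right h.payoff_hi_le
    (M.f_pos M.hi ⟨M.lo_lt_hi.le, le_rfl⟩).le
  -- In the sum of the bounds below and above `b`, the terms `f b * (fullRevelationPayoff b - U b)`
  -- cancel.
  rw [h.total_split hbI]
  linarith

end IsInterimOutcome

end RatingModel

/-! ### First-order condition for the minimum standard -/

namespace RatingModel

variable {M : RatingModel}

lemma intervalIntegrable_max {b : ℝ} (p : M.Quality) (hb : b ∈ Icc M.lo M.hi) :
    IntervalIntegrable (fun θ => max (p : ℝ) (M.fullRevelation θ) * M.f θ) volume b M.hi := by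
  have := intervalIntegrable_scheme (q := fun θ => max p (M.fullRevelation θ))
    (measurable_const.max M.monotone_fullRevelation.measurable) hb.1 hb.2 le_rfl
  have hmax : ∀ x y : M.Quality, ((max x y : M.Quality) : ℝ) = max (x : ℝ) y := fun x y =>
    Monotone.map_max (f := fun x : M.Quality => (x : ℝ)) fun x y hxy => hxy
  simpa only [hmax] using this

lemma integral_fullRevelation_le_max {b : ℝ} (p : M.Quality) (hb : b ∈ Icc M.lo M.hi) :
    ∫ θ in b..M.hi, (M.fullRevelation θ : ℝ) * M.f θ ≤
      ∫ θ in b..M.hi, max (p : ℝ) (M.fullRevelation θ) * M.f θ :=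
  intervalIntegral.integral_mono_on hb.2
    (intervalIntegrable_scheme M.monotone_fullRevelation.measurable hb.1 hb.2 le_rfl)
    (intervalIntegrable_max p hb) fun θ hθ =>
      mul_le_mul_of_nonneg_right (le_max_right _ _) (M.f_pos θ ⟨hb.1.trans hθ.1, hθ.2⟩).le

lemma integral_fullRevelation_lt_max {b : ℝ} (p : M.Quality) (hb : b ∈ Ico M.lo M.hi)
    (hp : (M.fullRevelation b : ℝ) < p) :
    ∫ θ in b..M.hi, (M.fullRevelation θ : ℝ) * M.f θ <
      ∫ θ in b..M.hi, max (p : ℝ) (M.fullRevelation θ) * M.f θ := by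
  obtain ⟨t, ht, htp⟩ := ((show ∀ᶠ a in 𝓝[>] b, a ∈ Ioo b M.hi from Ioo_mem_nhdsGT hb.2).and
    ((M.tendsto_fullRevelation b).eventually_lt_const hp)).exists
  have hbI : b ∈ Icc M.lo M.hi := ⟨hb.1, hb.2.le⟩
  have htI : t ∈ Icc M.lo M.hi := ⟨hb.1.trans ht.1.le, ht.2.le⟩
  have hm := M.monotone_fullRevelation.measurable
  have i1 := intervalIntegrable_scheme hm hb.1 ht.1.le ht.2.le
  have i2 := intervalIntegrable_scheme hm htI.1 ht.2.le le_rfl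
  have j := intervalIntegrable_max p hbI
  have hsub : uIcc b t ⊆ uIcc b M.hi := by
    rw [uIcc_of_le ht.1.le, uIcc_of_le hb.2.le]; exact Icc_subset_Icc_right ht.2.le
  have j1 := j.mono_set hsub
  rw [← intervalIntegral.integral_add_adjacent_intervals i1 i2,
    ← intervalIntegral.integral_add_adjacent_intervals j1 (intervalIntegrable_max p htI)]
  refine add_lt_add_of_lt_of_le ?_ (integral_fullRevelation_le_max p htI)
  rw [← sub_pos, ← intervalIntegral.integral_sub j1 i1]
  refine intervalIntegral.intervalIntegral_pos_of_pos_on (j1.sub i1) (fun θ hθ => ?_) ht.1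
  have h1 : (M.fullRevelation θ : ℝ) < p :=
    lt_of_le_of_lt (M.monotone_fullRevelation hθ.2.le) htp
  rw [← sub_mul]
  exact mul_pos (sub_pos.2 (h1.trans_le (le_max_left _ _)))
    (M.f_pos θ ⟨hb.1.trans hθ.1.le, hθ.2.le.trans ht.2.le⟩)

/-- A differentiable function that does not increase to the right of a point has nonpositive
derivative there. -/
lemma _root_.HasDerivAt.nonpos_of_eventually_le {G : ℝ → ℝ} {G' x : ℝ} (h : HasDerivAt G G' x)
    (hle : ∀ᶠ y in 𝓝[>] x, G y ≤ G x) : G' ≤ 0 := by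
  have := (hasDerivWithinAt_iff_tendsto_slope' (s := Ioi x) (by simp)).1 h.hasDerivWithinAt
  refine le_of_tendsto this ?_
  filter_upwards [hle, self_mem_nhdsWithin] with y hy hxy
  rw [slope_def_field]
  exact div_nonpos_of_nonpos_of_nonneg (sub_nonpos.2 hy) (sub_nonneg.2 (le_of_lt hxy))

/-- If no minimum standard improves on pooling the types below `b > 0` at the full-revelation
quality of `b`, then the types that are willing to produce this quality are those above some
`t ≥ lo`, and the density is on average at most `f t` on `[t, b]`. -/
lemma exists_threshold_of_minimumStandard_le {b V : ℝ} (hb : b ∈ Ico M.lo M.hi) (hb0 : 0 < b)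
    (hopt : ∀ p, M.expectedQuality (M.minimumStandard p) ≤ V)
    (hV₁ : V ≤ (∫ θ in M.lo..b, (M.fullRevelation b : ℝ) * M.f θ) +
      ∫ θ in b..M.hi, (M.fullRevelation θ : ℝ) * M.f θ)
    (hV₂ : ∀ t ∈ Icc M.lo b, t * M.fullRevelation b = M.c (M.fullRevelation b) →
      V ≤ (∫ θ in t..b, (M.fullRevelation b : ℝ) * M.f θ) +
        ∫ θ in b..M.hi, (M.fullRevelation θ : ℝ) * M.f θ) :
    ∃ t ∈ Ico M.lo b, t * M.fullRevelation b = M.c (M.fullRevelation b) ∧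
      ∫ θ in t..b, M.f θ ≤ M.f t * (b - t) := by
  have hbI : b ∈ Icc M.lo M.hi := ⟨hb.1, hb.2.le⟩
  obtain ⟨hr0, hr1⟩ := M.fullRevelation_mem_Ioo hb0 hb.2.le
  have hUpos := M.fullRevelationPayoff_pos hb0
  rw [fullRevelationPayoff] at hUpos
  have hdc := M.hasDerivAt_c_fullRevelation hb0 hb.2.le
  set r : ℝ := (M.fullRevelation b).1 with hr
  have hrm : r ∈ Icc 0 M.qmax := ⟨hr0.le, hr1.le⟩
  have hmem : ∀ᶠ p in 𝓝[>] r, p ∈ Ioo r M.qmax := Ioo_mem_nhdsGT hr1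
  have hlin : ∀ s : ℝ, M.c r < s * r → ∀ᶠ p in 𝓝[>] r, M.c p < s * p := fun s hs =>
    (hdc.continuousAt.eventually_lt (continuousAt_const.mul continuousAt_id) hs).filter_mono
      nhdsWithin_le_nhds
  -- Otherwise a standard slightly above `r` would still be met by all types and strictly raise
  -- quality.
  have hlo : M.lo * r ≤ M.c r := by
    by_contra! hcon
    obtain ⟨p, hp, hcp⟩ := (hmem.and (hlin _ hcon)).exists
    have hpm : p ∈ Icc 0 M.qmax := ⟨(hr0.trans hp.1).le, hp.2.le⟩
    have h1 := le_expectedQuality_minimumStandard ⟨p, hpm⟩ le_rfl hb.1 hb.2.le hcp.le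
    have h2 := integral_fullRevelation_lt_max ⟨p, hpm⟩ hb hp.1
    have hi := intervalIntegrable_f le_rfl hb.1 hb.2.le
    have h3 : ∫ θ in M.lo..b, r * M.f θ ≤ ∫ θ in M.lo..b, p * M.f θ :=
      intervalIntegral.integral_mono_on hb.1 (hi.const_mul _) (hi.const_mul _) fun θ hθ =>
        mul_le_mul_of_nonneg_right hp.1.le (M.f_pos θ ⟨hθ.1, hθ.2.trans hb.2.le⟩).le
    have h4 := hopt ⟨p, hpm⟩
    simp only at h1 h2
    linarith
  have ht : M.c r / r ∈ Ico M.lo b :=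
    ⟨(le_div_iff₀ hr0).2 hlo, (div_lt_iff₀ hr0).2 (by linarith)⟩
  have htr : M.c r / r * r = M.c r := div_mul_cancel₀ _ hr0.ne'
  refine ⟨M.c r / r, ht, htr, ?_⟩
  have hVt := hV₂ _ ⟨ht.1, ht.2.le⟩ htr
  -- A continuous extension of `f` gives a two-sided derivative even when the marginal type is `lo`.
  set F : ℝ → ℝ := IccExtend M.lo_lt_hi.le ((Icc M.lo M.hi).domRestrict M.f) with hF
  have hFc : Continuous F := (continuousOn_iff_continuous_domRestrict.1 M.f_cont).Icc_extend'
  have hFf : ∀ θ ∈ Icc M.lo M.hi, F θ = M.f θ := fun θ hθ => by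
    rw [hF, IccExtend_of_mem _ _ hθ]; rfl
  have hint : ∀ s ∈ Icc M.lo b, ∫ θ in s..b, M.f θ = ∫ θ in s..b, F θ := fun s hs =>
    intervalIntegral.integral_congr fun θ hθ => by
      rw [uIcc_of_le hs.2] at hθ
      exact (hFf θ ⟨hs.1.trans hθ.1, hθ.2.trans hb.2.le⟩).symm
  -- This is the quality of types below `b` under standard `p`; at `r` its derivative is `∫ f - f t
  -- * (b - t)` over `[t, b]`, with `t = c r / r`.
  have hder : HasDerivAt (fun p => p * -∫ θ in b..M.c p / p, F θ)
      ((-∫ θ in b..M.c r / r, F θ) + r * -(F (M.c r / r) * ((b * r - M.c r) / r ^ 2))) r := by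
    have hq : HasDerivAt (fun p => M.c p / p) ((b * r - M.c r) / r ^ 2) r := by
      refine (hdc.div (hasDerivAt_id' r) hr0.ne').congr_deriv ?_
      rw [mul_one]
    have hFd := (hFc.integral_hasStrictDerivAt b (M.c r / r)).hasDerivAt
    refine ((hasDerivAt_id' r).mul (hFd.comp r (h := fun p => M.c p / p) hq).neg).congr_deriv ?_
    rw [one_mul]
    rfl
  -- Only `p > r` is tested: this keeps the marginal type `c p / p` above `lo`, and a higher
  -- standard never lowers quality above `b`.
  have hnp := hder.nonpos_of_eventually_le (by
    filter_upwards [hmem, hlin b (by linarith)] with p hp hcp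
    have hp0 := hr0.trans hp.1
    have hpm : p ∈ Icc 0 M.qmax := ⟨hp0.le, hp.2.le⟩
    have hlt := M.c_lt_mul (div_pos hr0 hp0) ((div_lt_one hp0).2 hp.1) hpm hp0
    rw [div_mul_cancel₀ _ hp0.ne', div_mul_eq_mul_div, mul_comm, ← div_mul_eq_mul_div] at hlt
    have hst : M.c p / p ∈ Icc M.lo b := by
      refine ⟨ht.1.trans ((div_le_iff₀ hr0).2 hlt.le), (div_le_iff₀ hp0).2 hcp.le⟩
    have h1 := le_expectedQuality_minimumStandard ⟨p, hpm⟩ hst.1 hst.2 hb.2.le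
      (div_mul_cancel₀ _ hp0.ne').ge
    have h2 := integral_fullRevelation_le_max ⟨p, hpm⟩ hbI
    have h3 := hopt ⟨p, hpm⟩
    simp only [intervalIntegral.integral_const_mul] at h1 h2 hVt
    rw [hint _ hst] at h1
    rw [hint _ ⟨ht.1, ht.2.le⟩] at hVt
    rw [← intervalIntegral.integral_symm, ← intervalIntegral.integral_symm]
    linarith)
  rw [← intervalIntegral.integral_symm, hFf _ ⟨ht.1, ht.2.le.trans hb.2.le⟩,
    ← hint _ ⟨ht.1, ht.2.le⟩] at hnp
  have : r * -(M.f (M.c r / r) * ((b * r - M.c r) / r ^ 2)) =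
      -(M.f (M.c r / r) * (b - M.c r / r)) := by
    field_simp
  linarith

/-- An increasing continuous function whose average is at most its initial value is constant. -/
lemma _root_.MonotoneOn.eq_of_integral_le {f : ℝ → ℝ} {t b : ℝ} (hf : MonotoneOn f (Icc t b))
    (hc : ContinuousOn f (Icc t b)) (hle : ∫ θ in t..b, f θ ≤ f t * (b - t)) {x : ℝ}
    (hx : x ∈ Icc t b) : f x = f t := by
  have htb := hx.1.trans hx.2
  refine le_antisymm ?_ (hf ⟨le_rfl, htb⟩ hx hx.1)
  by_contra! hcon
  have htx : t < x := hx.1.lt_of_ne fun h => by rw [h] at hcon; exact hcon.false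
  have hpos := intervalIntegral.integral_pos (htx.trans_le hx.2) (hc.sub (continuousOn_const (c := f t)))
    (fun y hy => sub_nonneg.2 (hf ⟨le_rfl, htb⟩ ⟨hy.1.le, hy.2⟩ hy.1.le))
    ⟨x, hx, sub_pos.2 hcon⟩
  simp only [Pi.sub_apply] at hpos
  rw [intervalIntegral.integral_sub (hc.intervalIntegrable_of_Icc htb) intervalIntegrable_const,
    intervalIntegral.integral_const, smul_eq_mul] at hpos
  linarith

lemma _root_.MonotoneOn.Icc_of_Ico {f : ℝ → ℝ} {a b : ℝ} (hf : MonotoneOn f (Ico a b))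
    (hc : ContinuousOn f (Icc a b)) : MonotoneOn f (Icc a b) := by
  intro x hx y hy hxy
  rcases hy.2.lt_or_eq with hyb | rfl
  · exact hf ⟨hx.1, hxy.trans_lt hyb⟩ ⟨hy.1, hyb⟩ hxy
  · rcases hxy.lt_or_eq with hlt | rfl
    · have ht : Tendsto f (𝓝[<] y) (𝓝 (f y)) := by
        rw [← nhdsWithin_Ioo_eq_nhdsLT hlt]
        exact (hc y hy).mono_left (nhdsWithin_mono _ fun z hz => ⟨hx.1.trans hz.1.le, hz.2.le⟩)
      refine ge_of_tendsto ht ?_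
      filter_upwards [Ioo_mem_nhdsLT hlt] with z hz
      exact hf ⟨hx.1, hlt⟩ ⟨hx.1.trans hz.1.le, hz.2⟩ hz.1.le
    · exact le_rfl

end RatingModel

/-! ### The main theorem -/

/-- `b` is the start of the fully revealing region of the optimal deterministic rating `g`; the
types below `b` form its exclusion and bunching regions. -/
theorem mainTheorem6 (M : RatingModel) {S : Type} [MeasurableSpace S]
    (g : M.Quality → S) (hg : Measurable g) (q : M.Scheme)
    (hopt : M.IsOptimalDeterministic g hg q)
    (b : ℝ) (hb : b ∈ M.Types)
    (hreveal : Set.Ioo b M.hi ⊆ M.fullyRevealed q)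
    (hf_pool : MonotoneOn M.f (Set.Ico M.lo b))
    (hf_diff : DifferentiableOn ℝ M.f (Set.Ioo b M.hi))
    (hf_reveal : AntitoneOn M.f (Set.Ioo b M.hi))
    (helast : AntitoneOn (fun θ => θ * deriv M.f θ / M.f θ) (Set.Ioo b M.hi)) :
    M.IsOptimal (ProbabilityTheory.Kernel.deterministic g hg) q := by
  refine ⟨inferInstance, hopt.1, fun S' _ π' _ q' h' => ?_⟩
  have hstd : ∀ p, M.expectedQuality (M.minimumStandard p) ≤ M.expectedQuality q := fun p =>
    hopt.2 _ _ _ _ (M.implements_minimumStandard p)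
  obtain ⟨U', W', h'⟩ := h'.exists_isInterimOutcome
  have hmono : MonotoneOn M.f (Icc M.lo b) :=
    hf_pool.Icc_of_Ico (M.f_cont.mono (Icc_subset_Icc_right hb.2))
  rcases hb.2.eq_or_lt with rfl | hlt
  · obtain ⟨p, hp⟩ := h'.exists_minimumStandard_ge_of_monotoneOn hmono
    exact hp.trans (hstd p)
  have hbI : b ∈ Ico M.lo M.hi := ⟨hb.1, hlt⟩
  obtain ⟨U, W, h⟩ := hopt.1.exists_isInterimOutcome
  have hq : ∀ θ ∈ Ioo b M.hi, (q θ : ℝ) = M.fullRevelation θ := fun θ hθ =>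
    M.eq_fullRevelation (q θ).2 fun y hy => (hreveal hθ).2 ⟨y, hy⟩
  obtain ⟨hUb, hWb⟩ := h.le_fullRevelation_of_Ioo hbI hq
  have hV : M.expectedQuality q ≤ (∫ θ in M.lo..b, W θ * M.f θ) +
      ∫ θ in b..M.hi, (M.fullRevelation θ : ℝ) * M.f θ := by
    have h1 := h.tail hb
    rw [h.total_split hb]
    refine add_le_add le_rfl (h1.trans_eq ?_)
    rw [intervalIntegral.integral_of_le hb.2, intervalIntegral.integral_of_le hb.2,
      integral_Ioc_eq_integral_Ioo, integral_Ioc_eq_integral_Ioo]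
    exact setIntegral_congr_fun measurableSet_Ioo fun θ hθ => by simp only [hq θ hθ]
  have hWb' : ∀ θ ∈ Ico M.lo b, W θ ≤ M.fullRevelation b := fun θ hθ => hWb θ ⟨hθ.1, hθ.2.le⟩
  obtain ⟨t, ht, htq, hconst⟩ : ∃ t ∈ Icc M.lo b,
      t * M.fullRevelation b = M.c (M.fullRevelation b) ∧ ∀ θ ∈ Icc t b, M.f θ = M.f b := by
    rcases (M.lo_nonneg.trans hb.1).eq_or_lt with h0 | h0
    -- If `b = 0`, its full-revelation quality is `0`, and `t = b` leaves only one point to check.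
    · refine ⟨b, ⟨hb.1, le_rfl⟩, ?_, fun θ hθ => by rw [le_antisymm hθ.2 hθ.1]⟩
      rw [← h0, M.fullRevelation_zero, M.c_zero, mul_zero]
    · obtain ⟨t, ht, htq, hle⟩ := M.exists_threshold_of_minimumStandard_le hbI h0 hstd
        (hV.trans (add_le_add (h.integral_le_of_wage_le hb hWb') le_rfl))
        fun t ht htq => hV.trans (add_le_add
          (h.integral_le_of_monotoneOn hb hmono ht htq hWb' hUb) le_rfl)
      have hsub : Icc t b ⊆ Icc M.lo b := Icc_subset_Icc_left ht.1
      have heq : ∀ θ ∈ Icc t b, M.f θ = M.f t := fun θ hθ =>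
        (hmono.mono hsub).eq_of_integral_le
          (M.f_cont.mono (hsub.trans (Icc_subset_Icc_right hb.2))) hle hθ
      exact ⟨t, ⟨ht.1, ht.2.le⟩, htq, fun θ hθ =>
        (heq θ hθ).trans (heq b ⟨ht.2.le, le_rfl⟩).symm⟩
  have hder : ∀ θ ∈ Ioo b M.hi, HasDerivAt M.f (deriv M.f θ) θ := fun θ hθ =>
    (hf_diff.differentiableAt (Ioo_mem_nhds hθ.1 hθ.2)).hasDerivAt
  have hneg : ∀ θ ∈ Ioo b M.hi, deriv M.f θ ≤ 0 := fun θ hθ => by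
    rw [← derivWithin_of_isOpen isOpen_Ioo hθ]
    exact hf_reveal.derivWithin_nonpos
  refine (h'.expectedQuality_le hbI ht htq
    (fun θ hθ => hmono ⟨hθ.1, hθ.2.trans ht.2⟩ ⟨hb.1, le_rfl⟩ (hθ.2.trans ht.2))
    hconst hder hneg helast).trans ?_
  refine le_trans ?_ (hstd (M.fullRevelation b))
  exact (add_le_add le_rfl (RatingModel.integral_fullRevelation_le_max _ hb)).trans
    (RatingModel.le_expectedQuality_minimumStandard _ ht.1 ht.2 hb.2 htq.ge)
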